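/- Let $A=(a_{ij})$ be a finite square matrix with entries in $\{0,1\}$, and let $q>1$. Let $\Omega_A=\{\omega=(\omega_j)_{j\in\mathbb Z} : a_{\omega_j\omega_{j+1}}=1 \text{ for all } j\}$ be the two-sided and $\Omega_A^{+}=\{\omega=(\omega_j)_{j\ge 0} : a_{\omega_j\omega_{j+1}}=1 \text{ for all } j\ge 0\}$ the one-sided sequence space, each with the metric $d(\omega,\omega')=q^{-\min\{|j|\,:\,\omega_j\neq\omega'_j\}}$ for $\omega\ne\omega'$ (and $d(\omega,\omega)=0$), and let $\sigma_A$, $(\sigma_A\omega)_j=\omega_{j+1}$, be the shift (the subshift of finite type) on either space. For a homeomorphism (respectively a continuous map) $f$ of a metric space, let $\gamma(f)\in[0,\infty]$ be the supremum of all $\gamma>0$ such that $d(f^n(x),f^n(y))<\gamma$ for all $n\in\mathbb Z$ (respectively all $n\ge 0$) implies $x=y$ ($\gamma(f)=0$ if there is no such $\gamma$); $f$ is called expansive if such a $\gamma$ exists. Put $$h_E^+(f)=\limsup_{n\to\infty}-\tfrac1n\log\gamma(f^n),\qquad h_E^-(f)=\liminf_{n\to\infty}-\tfrac1n\log\gamma(f^n)$$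 in $[-\infty,\infty]$, with the convention $0\cdot(\pm\infty)=0$. Let $h$ denote topological entropy and $\dim_H$ Hausdorff dimension. (1) Suppose $\Omega_A\neq\emptyset$. Then $\sigma_A:\Omega_A\to\Omega_A$ is expansive and $$h_E^{+}(\sigma_A)\cdot\dim_H\Omega_A=h_E^{-}(\sigma_A)\cdot\dim_H\Omega_A=h(\sigma_A).$$ If $h(\sigma_A)>0$, then $h_E^{+}(\sigma_A)=h_E^{-}(\sigma_A)=\frac{\log q}{2}$. Moreover the limit $\lim_{k\to\infty}\frac1k\log\|A^k\|$ exists and is finite, and $$\dim_H\Omega_A=\frac{2}{\log q}\lim_{k\to\infty}\frac1k\log\|A^k\|.$$ (2) Suppose $\Omega_A^{+}\neq\emptyset$. Then $\sigma_A:\Omega_A^{+}\to\Omega_A^{+}$ is expansive and $$h_E^{+}(\sigma_A)\cdot\dim_H\Omega_A^{+}=h_E^{-}(\sigma_A)\cdot\dim_H\Omega_A^{+}=h(\sigma_A).$$ If $h(\sigma_A)>0$, then $h_E^{+}(\sigma_A)=h_E^{-}(\sigma_A)=\log q$. Moreover the limit $\lim_{k\to\infty}\frac1k\log\|A^k\|$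 exists and is finite, and $$\dim_H\Omega_A^{+}=\frac{1}{\log q}\lim_{k\to\infty}\frac1k\log\|A^k\|.$$ Here $\|\cdot\|$ is the maximal absolute row sum (the limit is the same for every matrix norm). -/

import Mathlib

open Filter Topology
open scoped ENNReal Matrix.Norms.Operator

/-! ### Expansive homeomorphisms and expansive maps of a metric space -/

section Expansive

variable {X : Type*} [MetricSpace X]

/-- `c > 0` separates the orbits of the homeomorphism `f`:
`d(fⁿ x, fⁿ y) < c` for all `n ∈ ℤ` forces `x = y`. -/
def IsExpansiveConst (f : X ≃ₜ X) (c : ℝ) : Prop :=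
  0 < c ∧ ∀ x y : X, (∀ n : ℤ, dist ((f ^ n) x) ((f ^ n) y) < c) → x = y

/-- A homeomorphism is expansive if some `c > 0` separates its orbits. -/
def IsExpansive (f : X ≃ₜ X) : Prop := ∃ c : ℝ, IsExpansiveConst f c

/-- The expansive constant `γ(f)`, the supremum of all `c` that separate the orbits of `f`.
(It is `0` if `f` is not expansive, and `∞` if `X` has at most one point.) -/
noncomputable def expansiveConst (f : X ≃ₜ X) : ℝ≥0∞ :=
  ⨆ (c : ℝ) (_ : IsExpansiveConst f c), ENNReal.ofReal c

/-- `h_E⁺(f) = limsup - (1/n) log γ(fⁿ)`. -/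
noncomputable def upperExpansiveDecay (f : X ≃ₜ X) : EReal :=
  limsup (fun n : ℕ => -ENNReal.log (expansiveConst (f ^ n)) / (n : EReal)) atTop

/-- `h_E⁻(f) = liminf - (1/n) log γ(fⁿ)`. -/
noncomputable def lowerExpansiveDecay (f : X ≃ₜ X) : EReal :=
  liminf (fun n : ℕ => -ENNReal.log (expansiveConst (f ^ n)) / (n : EReal)) atTop

/-- Version for maps: only forward orbits are compared. -/
def IsExpansiveConstMap (f : X → X) (c : ℝ) : Prop :=
  0 < c ∧ ∀ x y : X, (∀ n : ℕ, dist (f^[n] x) (f^[n] y) < c) → x = y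

/-- A map is (positively) expansive if some `c > 0` separates its forward orbits. -/
def IsExpansiveMap (f : X → X) : Prop := ∃ c : ℝ, IsExpansiveConstMap f c

/-- The expansive constant of a map. -/
noncomputable def expansiveConstMap (f : X → X) : ℝ≥0∞ :=
  ⨆ (c : ℝ) (_ : IsExpansiveConstMap f c), ENNReal.ofReal c

/-- `h_E⁺(f)` for a map. -/
noncomputable def upperExpansiveDecayMap (f : X → X) : EReal :=
  limsup (fun n : ℕ => -ENNReal.log (expansiveConstMap (f^[n])) / (n : EReal)) atTop

/-- `h_E⁻(f)` for a map. -/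
noncomputable def lowerExpansiveDecayMap (f : X → X) : EReal :=
  liminf (fun n : ℕ => -ENNReal.log (expansiveConstMap (f^[n])) / (n : EReal)) atTop

end Expansive

/-! ### The metric `q ^ (-min {|j| : ω_j ≠ ω'_j})` on sequences

The index set is `J = ℤ` with `size j = |j|`, or `J = ℕ` with `size j = j`. -/

section Metric

variable {J ι : Type*}

/-- `min {|j| : ω_j ≠ ω'_j}` (for `ω ≠ ω'`). -/
noncomputable def firstDiffSize (size : J → ℕ) (ω ω' : J → ι) : ℕ :=
  sInf {n : ℕ | ∃ j : J, size j = n ∧ ω j ≠ ω' j}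

open Classical in
/-- The distance `q ^ (-min {|j| : ω_j ≠ ω'_j})`, and `0` if `ω = ω'`. -/
noncomputable def seqDist (size : J → ℕ) (q : ℝ) (ω ω' : J → ι) : ℝ :=
  if ω = ω' then 0 else q ^ (-(firstDiffSize size ω ω' : ℤ))

theorem firstDiffSize_comm (size : J → ℕ) (ω ω' : J → ι) :
    firstDiffSize size ω ω' = firstDiffSize size ω' ω := by
  simp only [firstDiffSize, ne_comm]

theorem firstDiffSize_le (size : J → ℕ) {ω ω' : J → ι} {j : J} (h : ω j ≠ ω' j) :
    firstDiffSize size ω ω' ≤ size j :=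
  Nat.sInf_le ⟨j, rfl, h⟩

theorem exists_firstDiffSize (size : J → ℕ) {ω ω' : J → ι} (h : ω ≠ ω') :
    ∃ j : J, size j = firstDiffSize size ω ω' ∧ ω j ≠ ω' j := by
  obtain ⟨j, hj⟩ := Function.ne_iff.1 h
  exact Nat.sInf_mem (s := {n : ℕ | ∃ j : J, size j = n ∧ ω j ≠ ω' j}) ⟨size j, j, rfl, hj⟩

theorem seqDist_nonneg (size : J → ℕ) {q : ℝ} (hq : 1 < q) (ω ω' : J → ι) :
    0 ≤ seqDist size q ω ω' := by
  unfold seqDist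
  split_ifs
  · exact le_rfl
  · positivity

theorem seqDist_triangle (size : J → ℕ) {q : ℝ} (hq : 1 < q) (x y z : J → ι) :
    seqDist size q x z ≤ seqDist size q x y + seqDist size q y z := by
  by_cases hxz : x = z
  · have h1 := seqDist_nonneg size hq x y
    have h2 := seqDist_nonneg size hq y z
    rw [seqDist, if_pos hxz]
    positivity
  obtain ⟨j, hj, hne⟩ := exists_firstDiffSize size hxz
  by_cases hxy : x j = y j
  · have hyz : y j ≠ z j := hxy ▸ hne
    have hyz' : y ≠ z := fun h => hyz (h ▸ rfl)
    have h1 := seqDist_nonneg size hq x y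
    have h2 : seqDist size q x z ≤ seqDist size q y z := by
      rw [seqDist, seqDist, if_neg hxz, if_neg hyz']
      apply zpow_le_zpow_right₀ hq.le
      have := firstDiffSize_le size hyz
      omega
    linarith
  · have hxy' : x ≠ y := fun h => hxy (h ▸ rfl)
    have h1 := seqDist_nonneg size hq y z
    have h2 : seqDist size q x z ≤ seqDist size q x y := by
      rw [seqDist, seqDist, if_neg hxz, if_neg hxy']
      apply zpow_le_zpow_right₀ hq.le
      have := firstDiffSize_le size hxy
      omega
    linarith

/-- The metric space structure on sequences given by `seqDist`. -/
noncomputable abbrev seqMetricSpace (size : J → ℕ) (q : ℝ) (hq : 1 < q) :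
    MetricSpace (J → ι) where
  dist := seqDist size q
  dist_self x := by simp [seqDist]
  dist_comm x y := by
    by_cases h : x = y
    · rw [h]
    · rw [seqDist, seqDist, if_neg h, if_neg (Ne.symm h), firstDiffSize_comm]
  dist_triangle := seqDist_triangle size hq
  eq_of_dist_eq_zero {x y} h := by
    by_contra hxy
    change seqDist size q x y = 0 at h
    rw [seqDist, if_neg hxy] at h
    have : (0 : ℝ) < q ^ (-(firstDiffSize size x y : ℤ)) := by positivity
    linarith

/-- Reading two sequences through `g` with `|g(j)| ≤ |j| + 1` increases their distance by at most
the factor `q`. -/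
theorem seqDist_le_mul (size : J → ℕ) {q : ℝ} (hq : 1 < q) {ω ω' u u' : J → ι}
    (g : J → J) (hg : ∀ j, size (g j) ≤ size j + 1)
    (hu : ∀ j, u j = ω (g j)) (hu' : ∀ j, u' j = ω' (g j)) :
    seqDist size q u u' ≤ q * seqDist size q ω ω' := by
  have h0 := seqDist_nonneg size hq ω ω'
  by_cases h : u = u'
  · rw [seqDist, if_pos h]
    positivity
  obtain ⟨j, hj, hne⟩ := exists_firstDiffSize size h
  rw [hu, hu'] at hne
  have hω : ω ≠ ω' := fun e => hne (e ▸ rfl)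
  rw [seqDist, seqDist, if_neg h, if_neg hω, ← zpow_one_add₀ (by positivity : q ≠ 0)]
  apply zpow_le_zpow_right₀ hq.le
  have h1 := firstDiffSize_le size hne
  have h2 := hg j
  omega

end Metric

/-! ### Subshifts of finite type -/

section Shift

variable {ι : Type*}

/-- The two-sided space `Ω_A = {ω ∈ ι^ℤ : A_{ω_j ω_{j+1}} = 1 for all j}`; the parameter `q` is
the base of its metric. -/
def TwoSidedShift (A : Matrix ι ι ℝ) (_q : ℝ) : Type _ :=
  {ω : ℤ → ι // ∀ j : ℤ, A (ω j) (ω (j + 1)) = 1}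

/-- The one-sided space of all `ω ∈ ι^ℕ` with `A_{ω_j ω_{j+1}} = 1` for all `j`. -/
def OneSidedShift (A : Matrix ι ι ℝ) (_q : ℝ) : Type _ :=
  {ω : ℕ → ι // ∀ j : ℕ, A (ω j) (ω (j + 1)) = 1}

variable (A : Matrix ι ι ℝ) (q : ℝ) [hq : Fact (1 < q)]

noncomputable instance : MetricSpace (TwoSidedShift A q) :=
  MetricSpace.induced Subtype.val Subtype.val_injective (seqMetricSpace Int.natAbs q hq.out)

noncomputable instance : MetricSpace (OneSidedShift A q) :=
  MetricSpace.induced Subtype.val Subtype.val_injective (seqMetricSpace id q hq.out)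

theorem TwoSidedShift.dist_def (ω ω' : TwoSidedShift A q) :
    dist ω ω' = seqDist Int.natAbs q ω.1 ω'.1 := rfl

theorem OneSidedShift.dist_def (ω ω' : OneSidedShift A q) :
    dist ω ω' = seqDist id q ω.1 ω'.1 := rfl

/-- The shift `(σ_A ω)_j = ω_{j+1}` on the two-sided space, with inverse `ω ↦ (ω_{j-1})_j`. -/
def twoSidedShiftMap : TwoSidedShift A q ≃ₜ TwoSidedShift A q where
  toFun ω := ⟨fun j => ω.1 (j + 1), fun j => ω.2 (j + 1)⟩
  invFun ω := ⟨fun j => ω.1 (j - 1), fun j => by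
    have h := ω.2 (j - 1)
    rwa [show j - 1 + 1 = j + 1 - 1 by ring] at h⟩
  left_inv ω := Subtype.ext (funext fun j => congrArg ω.1 (sub_add_cancel j 1))
  right_inv ω := Subtype.ext (funext fun j => congrArg ω.1 (add_sub_cancel_right j 1))
  continuous_toFun :=
    (LipschitzWith.of_dist_le' (K := q) fun _ _ => seqDist_le_mul Int.natAbs hq.out (fun j => j + 1)
      (fun j => by omega) (fun _ => rfl) (fun _ => rfl)).continuous
  continuous_invFun :=
    (LipschitzWith.of_dist_le' (K := q) fun _ _ => seqDist_le_mul Int.natAbs hq.out (fun j => j - 1)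
      (fun j => by omega) (fun _ => rfl) (fun _ => rfl)).continuous

/-- The shift `(σ_A ω)_j = ω_{j+1}` on the one-sided space. -/
def oneSidedShiftMap : OneSidedShift A q → OneSidedShift A q :=
  fun ω => ⟨fun j => ω.1 (j + 1), fun j => ω.2 (j + 1)⟩

theorem continuous_oneSidedShiftMap : Continuous (oneSidedShiftMap A q) :=
  (LipschitzWith.of_dist_le' (K := q) fun _ _ => seqDist_le_mul id hq.out (fun j => j + 1)
    (fun _ => le_rfl) (fun _ => rfl) (fun _ => rfl)).continuous

end Shift

/-! Everything is compared with one number `l`, the limit of `log ‖Aᵏ‖ / k`. It exists by Fekete's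
lemma, and it is the growth rate of the number of admissible words, because the entries of `Aⁿ`
count words with given end letters (`pow_apply_eq_card`).

Upper bounds come from cylinders. About `e^{ln}` of them, up to subexponential factors, resolve
orbits of length `n`, so the entropy is at most `l`. A cylinder of diameter `q⁻ⁿ` fixes about `n`
letters on the one-sided space and about `2n` on the two-sided one. Hence the dimension is at most
`l / log q`, respectively `2l / log q`.

Lower bounds come from horseshoes: for each `s < l` some vertex carries at least `e^{sL}` loops of a
common length `L` (`exists_exp_le_pow_apply`), and loops at one vertex concatenate freely. No
irreducible components or Perron–Frobenius theory are used. If loops were scarcer at every vertex,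
the Green function of `e^{-l} A` would be finite on the diagonal, hence everywhere
(`green_ne_top_of_diagonal`), contradicting `‖Aⁿ‖ ≥ e^{ln}`. Free concatenation gives separated
orbits (`le_coverEntropy_of_separated`) and a Hölder map onto a cube through base-`N` digits
(`le_dimH_of_digits`).

The expansive constant of `σⁿ` is governed by how long a window must be for its translates by
multiples of `n` to cover the index set: radius about `n/2` on `ℤ`, length about `n` on `ℕ`. With a
horseshoe, two points can differ only inside a gap left by shorter windows, so the decay rates are
`log q / 2` and `log q`. If `l = 0`, dimension and entropy vanish and the product formula holds by
convention. -/

/-! ### Matrix powers and admissible words -/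

section Words

variable {ι : Type*} {A : Matrix ι ι ℝ}

/-- A finite word is admissible if all its transitions are allowed. -/
def IsAdmissible (A : Matrix ι ι ℝ) {n : ℕ} (w : Fin (n + 1) → ι) : Prop :=
  ∀ k : Fin n, A (w k.castSucc) (w k.succ) = 1

theorem isAdmissible_cons {n : ℕ} (a : ι) (v : Fin (n + 1) → ι) :
    IsAdmissible A (Fin.cons a v : Fin (n + 2) → ι) ↔ A a (v 0) = 1 ∧ IsAdmissible A v := by
  simp only [IsAdmissible, Fin.forall_fin_succ (n := n)]
  simp

variable [Fintype ι] [DecidableEq ι]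

open Classical in
-- Splitting off the first letter of a word matches `A ^ (n + 1) = A * A ^ n`; a `0`-`1` entry is
-- the indicator that the first transition is allowed.
theorem pow_apply_eq_card (hA : ∀ i j, A i j = 0 ∨ A i j = 1) (n : ℕ) (i j : ι) :
    (A ^ n) i j = Fintype.card
      {w : Fin (n + 1) → ι // w 0 = i ∧ w (Fin.last n) = j ∧ IsAdmissible A w} := by
  rw [Fintype.card_subtype, Finset.card_filter]
  push_cast
  induction n generalizing i with
  | zero =>
    rw [← (Equiv.funUnique (Fin 1) ι).symm.sum_comp]
    simp [IsAdmissible, Matrix.one_apply, ite_and]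
  | succ n ih =>
    rw [pow_succ', Matrix.mul_apply, ← (Fin.consEquiv fun _ : Fin (n + 2) => ι).sum_comp,
      Fintype.sum_prod_type]
    have h1 : ∀ (x : ι) (v : Fin (n + 1) → ι),
        (Fin.consEquiv fun _ : Fin (n + 2) => ι) (x, v) = (Fin.cons x v : Fin (n + 2) → ι) :=
      fun _ _ => rfl
    simp only [h1, isAdmissible_cons, Fin.cons_zero, ← Fin.succ_last, Fin.cons_succ, ih,
      Finset.mul_sum]
    rw [Finset.sum_comm]
    conv_rhs => rw [Finset.sum_comm]
    refine Finset.sum_congr rfl fun v _ => ?_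
    rw [Finset.sum_eq_single (v 0) (fun b _ hb => by simp [hb.symm]) (by simp),
      Finset.sum_eq_single i (fun b _ hb => by simp [hb]) (by simp)]
    rcases hA i (v 0) with h | h <;> simp [h]

theorem pow_apply_nonneg (hA : ∀ i j, A i j = 0 ∨ A i j = 1) (n : ℕ) (i j : ι) :
    0 ≤ (A ^ n) i j := by
  classical
  rw [pow_apply_eq_card hA]
  positivity

theorem sum_row_le_norm (B : Matrix ι ι ℝ) (i : ι) : ∑ j, B i j ≤ ‖B‖ := by
  have h1 : ∑ j, ‖B i j‖₊ ≤ ‖B‖₊ := by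
    rw [Matrix.linfty_opNNNorm_def]
    exact Finset.le_sup (f := fun i => ∑ j, ‖B i j‖₊) (Finset.mem_univ i)
  calc ∑ j, B i j ≤ ∑ j, ‖B i j‖ := Finset.sum_le_sum fun j _ => Real.le_norm_self _
    _ = ((∑ j, ‖B i j‖₊ : NNReal) : ℝ) := by push_cast; rfl
    _ ≤ ‖B‖ := by exact_mod_cast h1

theorem norm_le_sum {B : Matrix ι ι ℝ} (hB : ∀ i j, 0 ≤ B i j) : ‖B‖ ≤ ∑ i, ∑ j, B i j := by
  have h1 : ‖B‖₊ ≤ ∑ i, ∑ j, ‖B i j‖₊ := by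
    rw [Matrix.linfty_opNNNorm_def]
    exact Finset.sup_le fun i hi =>
      Finset.single_le_sum (f := fun i => ∑ j, ‖B i j‖₊) (fun _ _ => zero_le) hi
  calc ‖B‖ ≤ ((∑ i, ∑ j, ‖B i j‖₊ : NNReal) : ℝ) := by exact_mod_cast h1
    _ = ∑ i, ∑ j, B i j := by
      push_cast
      exact Finset.sum_congr rfl fun i _ => Finset.sum_congr rfl fun j _ =>
        Real.norm_of_nonneg (hB i j)

open Classical in
/-- The number of admissible words with `n` transitions is at most `|ι| ‖Aⁿ‖`. -/
theorem card_isAdmissible_le (hA : ∀ i j, A i j = 0 ∨ A i j = 1) (n : ℕ) :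
    (Fintype.card {w : Fin (n + 1) → ι // IsAdmissible A w} : ℝ) ≤ Fintype.card ι * ‖A ^ n‖ := by
  calc (Fintype.card {w : Fin (n + 1) → ι // IsAdmissible A w} : ℝ)
      = ∑ i, ∑ j, (A ^ n) i j := by
        simp only [pow_apply_eq_card hA, Fintype.card_subtype, Finset.card_filter]
        push_cast
        simp_rw [Finset.sum_comm (s := Finset.univ (α := ι)) (t := Finset.univ (α := Fin (n+1) → ι))]
        refine Finset.sum_congr rfl fun w _ => ?_
        simp [ite_and]
    _ ≤ ∑ i : ι, ‖A ^ n‖ := Finset.sum_le_sum fun i _ => sum_row_le_norm _ i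
    _ = _ := by simp

theorem one_le_norm_pow (hA : ∀ i j, A i j = 0 ∨ A i j = 1) {n : ℕ} {w : Fin (n + 1) → ι}
    (hw : IsAdmissible A w) : 1 ≤ ‖A ^ n‖ := by
  classical
  have h1 : (1 : ℝ) ≤ (A ^ n) (w 0) (w (Fin.last n)) := by
    rw [pow_apply_eq_card hA]
    have : 0 < Fintype.card {v : Fin (n + 1) → ι //
        v 0 = w 0 ∧ v (Fin.last n) = w (Fin.last n) ∧ IsAdmissible A v} :=
      Fintype.card_pos_iff.2 ⟨⟨w, rfl, rfl, hw⟩⟩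
    exact_mod_cast this
  exact h1.trans ((Finset.single_le_sum (f := fun j => (A ^ n) (w 0) j)
    (fun j _ => pow_apply_nonneg hA n _ j) (Finset.mem_univ _)).trans (sum_row_le_norm _ _))

/-- The growth rate of `‖Aᵏ‖` exists and is attained from above. -/
theorem exists_growth_rate {A : Matrix ι ι ℝ} (h : ∀ n, 1 ≤ ‖A ^ n‖) :
    ∃ l : ℝ, 0 ≤ l ∧ Tendsto (fun k : ℕ => 1 / (k : ℝ) * Real.log ‖A ^ k‖) atTop (𝓝 l) ∧
      ∀ n : ℕ, Real.exp (l * n) ≤ ‖A ^ n‖ := by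
  -- Submultiplicativity of the norm; by Fekete the limit is also the infimum of `log ‖Aⁿ‖ / n`,
  -- which yields the bound valid for every `n`.
  have hsub : Subadditive fun n => Real.log ‖A ^ n‖ := fun m n => by
    have hm := h m
    have hn := h n
    rw [← Real.log_mul (by positivity) (by positivity)]
    refine Real.log_le_log (by linarith [h (m + n)]) ?_
    rw [pow_add]
    exact norm_mul_le _ _
  have h0 : ∀ n : ℕ, 0 ≤ Real.log ‖A ^ n‖ / n := fun n =>
    div_nonneg (Real.log_nonneg (h n)) n.cast_nonneg
  have hb : BddBelow (Set.range fun n : ℕ => Real.log ‖A ^ n‖ / n) :=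
    ⟨0, by rintro _ ⟨n, rfl⟩; exact h0 n⟩
  have ht := hsub.tendsto_lim hb
  refine ⟨hsub.lim, ge_of_tendsto' ht h0, ?_, fun n => ?_⟩
  · simpa only [one_div, inv_mul_eq_div] using ht
  · rcases eq_or_ne n 0 with rfl | hn
    · simpa using h 0
    · have := hsub.lim_le_div hb hn
      rw [le_div_iff₀ (by positivity)] at this
      exact (Real.le_log_iff_exp_le (by linarith [h n])).1 this

end Words

/-! ### Finiteness of Green functions of nonnegative matrices -/

section Green

variable {ι : Type*} [Fintype ι] [DecidableEq ι]

/-- The Green function `∑ₙ Xⁿ` of a nonnegative matrix. -/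
noncomputable def green (X : Matrix ι ι ℝ≥0∞) (i j : ι) : ℝ≥0∞ := ∑' n : ℕ, (X ^ n) i j

theorem sum_pow_succ (X : Matrix ι ι ℝ≥0∞) (n : ℕ) (i j : ι) :
    ∑ k ∈ Finset.range (n + 1), (X ^ k) i j =
      (1 : Matrix ι ι ℝ≥0∞) i j + ∑ m, X i m * ∑ k ∈ Finset.range n, (X ^ k) m j := by
  rw [Finset.sum_range_succ', add_comm, pow_zero]
  simp only [pow_succ', Matrix.mul_apply, Finset.mul_sum]
  rw [Finset.sum_comm]

theorem green_eq_add (X : Matrix ι ι ℝ≥0∞) (i j : ι) :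
    green X i j = (1 : Matrix ι ι ℝ≥0∞) i j + ∑ k, X i k * green X k j := by
  simp only [green]
  rw [tsum_eq_zero_add' ENNReal.summable, pow_zero]
  congr 1
  simp only [← ENNReal.tsum_mul_left, pow_succ', Matrix.mul_apply]
  rw [Summable.tsum_finsetSum fun _ _ => ENNReal.summable]

/-- Minimality of the Green function among the supersolutions of its equation. -/
theorem mul_green_le {X : Matrix ι ι ℝ≥0∞} {j : ι} {w : ℝ≥0∞} {v : ι → ℝ≥0∞}
    (h : ∀ i, w * (1 : Matrix ι ι ℝ≥0∞) i j + ∑ k, X i k * v k ≤ v i) (i : ι) :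
    w * green X i j ≤ v i := by
  rw [green, ← ENNReal.tsum_mul_left]
  refine ENNReal.tsum_le_of_sum_range_le fun n => ?_
  rw [← Finset.mul_sum]
  induction n generalizing i with
  | zero => simp
  | succ n ih =>
    rw [sum_pow_succ, mul_add]
    refine le_trans (add_le_add_right ?_ _) (h i)
    rw [Finset.mul_sum]
    refine Finset.sum_le_sum fun m _ => ?_
    rw [mul_left_comm]
    exact mul_le_mul_right (ih m) _

/-- `green X` is a supersolution of the equation for `Y`, so minimality applies. -/
theorem green_mono {X Y : Matrix ι ι ℝ≥0∞} (h : ∀ i j, Y i j ≤ X i j) (i j : ι) :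
    green Y i j ≤ green X i j := by
  have := mul_green_le (X := Y) (j := j) (w := 1) (v := fun i => green X i j) (fun i => by
    conv_rhs => rw [green_eq_add]
    rw [one_mul]
    exact add_le_add_right (Finset.sum_le_sum fun k _ => mul_le_mul_left (h i k) _) _) i
  simpa using this

/-- If every diagonal entry of the Green function is finite, then so is every entry. -/
theorem green_ne_top_of_diagonal (X : Matrix ι ι ℝ≥0∞) (hX : ∀ i j, X i j ≠ ∞)
    (hd : ∀ a, green X a a ≠ ∞) (i j : ι) : green X i j ≠ ∞ := by
  -- Induction on a set of rows outside which the matrix vanishes.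
  suffices H : ∀ (S : Finset ι) (X : Matrix ι ι ℝ≥0∞), (∀ i j, X i j ≠ ∞) →
      (∀ a, green X a a ≠ ∞) → (∀ i ∉ S, ∀ j, X i j = 0) → ∀ i j, green X i j ≠ ∞ from
    H Finset.univ X hX hd (by simp) i j
  intro S
  induction S using Finset.induction_on with
  | empty =>
    intro X _ _ hS i j
    rw [green_eq_add]
    simp only [hS _ (Finset.notMem_empty _), zero_mul, Finset.sum_const_zero, add_zero,
      Matrix.one_apply]
    split_ifs <;> simp
  | insert a S _ ih =>
    intro X hX hd hS i j
    -- Clearing row `a` stops paths at their first visit to `a`.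
    let Y : Matrix ι ι ℝ≥0∞ := fun i j => if i = a then 0 else X i j
    have hYX : ∀ i j, Y i j ≤ X i j := fun i j => by
      simp only [Y]
      split_ifs <;> simp
    have hY : ∀ i j, green Y i j ≠ ∞ := by
      refine ih Y (fun i j => ne_top_of_le_ne_top (hX i j) (hYX i j))
        (fun b => ne_top_of_le_ne_top (hd b) (green_mono hYX b b)) fun i hi j => ?_
      by_cases hia : i = a
      · simp [Y, hia]
      · simp only [Y, if_neg hia]
        exact hS i (by simp [hia, hi]) j
    have hYa : ∀ j, green Y a j = (1 : Matrix ι ι ℝ≥0∞) a j := fun j => by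
      rw [green_eq_add]
      simp [Y]
    -- `p` is the weight of first returns to `a`; `c` is the weight of nonempty paths from `a` to
    -- `j` that are stopped on returning to `a`.
    set p := ∑ m, X a m * green Y m a with hp
    set c := ∑ m, X a m * green Y m j with hc
    have hcf : c ≠ ∞ := ENNReal.sum_ne_top.2 fun m _ => ENNReal.mul_ne_top (hX a m) (hY m j)
    have hle : ∀ m, green X a a * green Y m a ≤ green X m a := by
      refine mul_green_le fun i => ?_
      by_cases hia : i = a
      · subst hia
        simp [Y]
      · conv_rhs => rw [green_eq_add]
        simp [Y, hia]
    -- Renewal: a return weight of at least `1` would give `1 + green X a a ≤ green X a a`,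
    -- impossible for a finite value.
    have hp1 : p < 1 := by
      by_contra hcon
      rw [not_lt] at hcon
      have h1 : 1 + green X a a ≤ green X a a := by
        conv_rhs => rw [green_eq_add]
        rw [Matrix.one_apply_eq]
        refine add_le_add_right ?_ _
        calc green X a a = green X a a * 1 := (mul_one _).symm
          _ ≤ green X a a * p := mul_le_mul_right hcon _
          _ = ∑ m, X a m * (green X a a * green Y m a) := by
            rw [hp, Finset.mul_sum]
            exact Finset.sum_congr rfl fun m _ => mul_left_comm _ _ _
          _ ≤ _ := Finset.sum_le_sum fun m _ => mul_le_mul_right (hle m) _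
      have h2 := ENNReal.add_lt_add_right (hd a) (zero_lt_one (α := ℝ≥0∞))
      rw [zero_add] at h2
      exact absurd (h2.trans_le h1) (lt_irrefl _)
    have hq0 : 1 - p ≠ 0 := (tsub_pos_of_lt hp1).ne'
    -- The solution of `t = c + p * t`, which sums over the number of returns to `a`. With it,
    -- splitting paths at the first visit to `a` produces a finite supersolution for `X`.
    set t := c / (1 - p) with ht
    have htf : t ≠ ∞ := ENNReal.div_ne_top hcf hq0
    have htc : c + p * t = t := by
      have h1 : t * (1 - p) = c := ENNReal.div_mul_cancel hq0 (by simp)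
      calc c + p * t = t * ((1 - p) + p) := by rw [mul_add, h1, mul_comm t p]
        _ = t := by rw [tsub_add_cancel_of_le hp1.le, mul_one]
    have key := mul_green_le (X := X) (j := j) (w := 1)
      (v := fun i => green Y i j + green Y i a * t) (fun i => by
        have hsum : ∀ Z : Matrix ι ι ℝ≥0∞, ∑ k, Z i k * (green Y k j + green Y k a * t) =
            ∑ k, Z i k * green Y k j + (∑ k, Z i k * green Y k a) * t := fun Z => by
          simp only [mul_add, Finset.sum_add_distrib, Finset.sum_mul, mul_assoc]
        rw [one_mul, hsum]
        by_cases hia : i = a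
        · subst hia
          rw [← hp, ← hc, htc, hYa, hYa, Matrix.one_apply_eq, one_mul]
        · have hXY : ∀ k, X i k = Y i k := fun k => by simp [Y, hia]
          rw [green_eq_add Y i j, green_eq_add Y i a, Matrix.one_apply_ne hia, zero_add]
          simp only [hXY]
          rw [add_assoc]) i
    rw [one_mul] at key
    exact ne_top_of_le_ne_top
      (ENNReal.add_ne_top.2 ⟨hY i j, ENNReal.mul_ne_top (hY i a) htf⟩) key

end Green

/-! ### Horseshoes from the growth of matrix powers -/

section Horseshoe

variable {ι : Type*} {A : Matrix ι ι ℝ}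

/-- `N` distinct admissible words of length `L` that can be concatenated freely. -/
structure Horseshoe (A : Matrix ι ι ℝ) (L N : ℕ) where
  /-- The words. -/
  word : Fin N → ℕ → ι
  injective : ∀ b c, (∀ i < L, word b i = word c i) → b = c
  step : ∀ b i, i + 1 < L → A (word b i) (word b (i + 1)) = 1
  glue : ∀ b c, A (word b (L - 1)) (word c 0) = 1

variable [Fintype ι] [DecidableEq ι]

/-- Below the growth rate of `‖Aⁿ‖` there is a vertex with many loops of some fixed length. -/
theorem exists_exp_le_pow_apply (hA : ∀ i j, A i j = 0 ∨ A i j = 1) {l s : ℝ} (hs : s < l)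
    (hl : ∀ n : ℕ, Real.exp (l * n) ≤ ‖A ^ n‖) :
    ∃ (L : ℕ) (a : ι), 0 < L ∧ Real.exp (s * L) ≤ (A ^ L) a a := by
  by_contra! hcon
  -- This normalisation puts the growth rate at the critical value: the entries of `X ^ n` sum to at
  -- least `1`, while the scarcity of loops in `hcon` makes the diagonal series geometrically
  -- summable.
  let X : Matrix ι ι ℝ≥0∞ := fun i j => ENNReal.ofReal (Real.exp (-l) * A i j)
  have hA0 : ∀ i j, 0 ≤ A i j := fun i j => by simpa using pow_apply_nonneg hA 1 i j
  have hX : ∀ (n : ℕ) (i j : ι), (X ^ n) i j = ENNReal.ofReal (Real.exp (-l * n) * (A ^ n) i j) := by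
    intro n
    induction n with
    | zero =>
      intro i j
      by_cases h : i = j <;> simp [h]
    | succ n ih =>
      intro i j
      rw [pow_succ', pow_succ', Matrix.mul_apply, Matrix.mul_apply, Finset.mul_sum,
        ENNReal.ofReal_sum_of_nonneg fun k _ => mul_nonneg (Real.exp_pos _).le
          (mul_nonneg (hA0 i k) (pow_apply_nonneg hA n k j))]
      refine Finset.sum_congr rfl fun k _ => ?_
      rw [ih, ← ENNReal.ofReal_mul (mul_nonneg (Real.exp_pos _).le (hA0 i k))]
      congr 1
      push_cast
      rw [show -l * ((n : ℝ) + 1) = -l + -l * n by ring, Real.exp_add]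
      ring
  have hgeom : Summable fun n : ℕ => Real.exp ((s - l) * n) := by
    have := Real.summable_exp_nat_mul_iff.2 (sub_neg.2 hs)
    simpa only [mul_comm] using this
  have hdiag : ∀ a, green X a a ≠ ∞ := by
    intro a
    refine ne_top_of_le_ne_top (hgeom.tsum_ofReal_ne_top) (ENNReal.tsum_le_tsum fun n => ?_)
    rw [hX]
    refine ENNReal.ofReal_le_ofReal ?_
    rcases Nat.eq_zero_or_pos n with rfl | hn
    · simp
    · rw [show (s - l) * (n : ℝ) = -l * n + s * n by ring, Real.exp_add]
      exact mul_le_mul_of_nonneg_left (hcon n a hn).le (Real.exp_pos _).le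
  have hfin := green_ne_top_of_diagonal X (fun _ _ => ENNReal.ofReal_ne_top) hdiag
  have hsum : ∑' n : ℕ, ∑ i, ∑ j, (X ^ n) i j ≠ ∞ := by
    rw [Summable.tsum_finsetSum fun _ _ => ENNReal.summable]
    refine ENNReal.sum_ne_top.2 fun i _ => ?_
    rw [Summable.tsum_finsetSum fun _ _ => ENNReal.summable]
    exact ENNReal.sum_ne_top.2 fun j _ => hfin i j
  have hge : ∀ n : ℕ, 1 ≤ ∑ i, ∑ j, (X ^ n) i j := by
    intro n
    have h1 : ∑ i, ∑ j, (X ^ n) i j =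
        ENNReal.ofReal (Real.exp (-l * n) * ∑ i, ∑ j, (A ^ n) i j) := by
      have h0 : ∀ i j, 0 ≤ Real.exp (-l * n) * (A ^ n) i j := fun i j =>
        mul_nonneg (Real.exp_pos _).le (pow_apply_nonneg hA n i j)
      simp only [hX, Finset.mul_sum]
      rw [ENNReal.ofReal_sum_of_nonneg fun i _ => Finset.sum_nonneg fun j _ => h0 i j]
      exact Finset.sum_congr rfl fun i _ =>
        (ENNReal.ofReal_sum_of_nonneg fun j _ => h0 i j).symm
    rw [h1, ← ENNReal.ofReal_one]
    refine ENNReal.ofReal_le_ofReal ?_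
    calc (1 : ℝ) = Real.exp (-l * n) * Real.exp (l * n) := by rw [← Real.exp_add]; simp
      _ ≤ _ := mul_le_mul_of_nonneg_left
        ((hl n).trans (norm_le_sum (pow_apply_nonneg hA n))) (Real.exp_pos _).le
  have ht := ENNReal.tendsto_atTop_zero_of_tsum_ne_top hsum
  exact absurd (ge_of_tendsto' ht hge) (by simp)

/-- Take the loops of length `L` at one vertex `a` and drop the final letter. The last transition of
each leads back to `a`, the first letter of all of them, so any two can be glued. -/
theorem exists_horseshoe (hA : ∀ i j, A i j = 0 ∨ A i j = 1) {l s : ℝ} (hs : s < l)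
    (hl : ∀ n : ℕ, Real.exp (l * n) ≤ ‖A ^ n‖) :
    ∃ L N : ℕ, 0 < L ∧ Real.exp (s * L) ≤ N ∧ Nonempty (Horseshoe A L N) := by
  classical
  obtain ⟨L, a, hL, h⟩ := exists_exp_le_pow_apply hA hs hl
  rw [pow_apply_eq_card hA] at h
  refine ⟨L, _, hL, h, ⟨?_⟩⟩
  let e := (Fintype.equivFin
    {w : Fin (L + 1) → ι // w 0 = a ∧ w (Fin.last L) = a ∧ IsAdmissible A w}).symm
  have hstep : ∀ b i, i < L →
      A ((e b).1 (Fin.ofNat (L + 1) i)) ((e b).1 (Fin.ofNat (L + 1) (i + 1))) = 1 := by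
    intro b i hi
    have := (e b).2.2.2 ⟨i, hi⟩
    convert this using 3 <;> ext <;> simp <;> omega
  have hlast : ∀ b, (e b).1 (Fin.ofNat (L + 1) L) = a := fun b => by
    convert (e b).2.2.1 using 2
    ext
    simp
  have hzero : ∀ b, (e b).1 (Fin.ofNat (L + 1) 0) = a := fun b => (e b).2.1
  refine ⟨fun b i => (e b).1 (Fin.ofNat (L + 1) i), fun b c hbc => ?_, fun b i hi =>
    hstep b i (by omega), fun b c => ?_⟩
  · refine e.injective (Subtype.ext (funext fun i => ?_))
    have hi := Fin.ofNat_val_eq_self (n := L + 1) i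
    rcases lt_or_ge i.1 L with h1 | h1
    · have := hbc i h1
      simpa only [Fin.ofNat_val_eq_self] using this
    · have h2 : i.1 = L := by omega
      have h3 : i = Fin.ofNat (L + 1) L := by ext; simp [h2]
      rw [h3, hlast, hlast]
  · have := hstep b (L - 1) (by omega)
    rw [show L - 1 + 1 = L by omega, hlast] at this
    rw [hzero]
    exact this

end Horseshoe

/-! ### Agreement of sequences and concatenation of words -/

section Agreement

variable {J ι : Type*} {size : J → ℕ} {q : ℝ} {x y : J → ι} {m : ℕ}

theorem seqDist_le_of_agree (hq : 1 < q) (h : ∀ j, size j < m → x j = y j) :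
    seqDist size q x y ≤ q ^ (-(m : ℤ)) := by
  by_cases hxy : x = y
  · rw [seqDist, if_pos hxy]
    positivity
  · obtain ⟨j, hj, hne⟩ := exists_firstDiffSize size hxy
    rw [seqDist, if_neg hxy]
    apply zpow_le_zpow_right₀ hq.le
    have : ¬ size j < m := fun hlt => hne (h j hlt)
    omega

/-- Strictness pushes the first disagreement beyond `m`, so index size `m` itself is included. -/
theorem agree_of_seqDist_lt (hq : 1 < q) (h : seqDist size q x y < q ^ (-(m : ℤ))) {j : J}
    (hj : size j ≤ m) : x j = y j := by
  by_contra hne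
  have hxy : x ≠ y := fun e => hne (e ▸ rfl)
  rw [seqDist, if_neg hxy, zpow_lt_zpow_iff_right₀ hq] at h
  have := firstDiffSize_le size hne
  omega

/-- Sequences at positive distance differ exactly at the index size given by their distance. -/
theorem exists_seqDist_eq (hxy : x ≠ y) :
    ∃ m : ℕ, seqDist size q x y = q ^ (-(m : ℤ)) ∧ ∀ j, size j < m → x j = y j :=
  ⟨firstDiffSize size x y, by rw [seqDist, if_neg hxy], fun j hj => by
    by_contra hne
    have := firstDiffSize_le size hne
    omega⟩

end Agreement

namespace Horseshoe

variable {ι : Type*} {A : Matrix ι ι ℝ} {L N : ℕ} (H : Horseshoe A L N)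

/-- The concatenation of the words with labels `β`. -/
def concat (β : ℤ → Fin N) (j : ℤ) : ι := H.word (β (j / L)) (j % L).toNat

theorem concat_apply (β : ℤ → Fin N) (k : ℤ) {i : ℕ} (hi : i < L) :
    H.concat β (k * L + i) = H.word (β k) i := by
  have hL : (L : ℤ) ≠ 0 := by omega
  have h1 : (k * L + i : ℤ) / L = k := by
    rw [add_comm, Int.add_mul_ediv_right _ _ hL, Int.ediv_eq_zero_of_lt (by omega) (by omega),
      zero_add]
  have h2 : (k * L + i : ℤ) % L = i := by
    rw [add_comm, Int.add_mul_emod_self_right, Int.emod_eq_of_lt (by omega) (by omega)]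
  rw [concat, h1, h2, Int.toNat_natCast]

theorem exists_eq_mul_add (hL : 0 < L) (j : ℤ) : ∃ (k : ℤ) (i : ℕ), i < L ∧ j = k * L + i := by
  have h0 := Int.emod_nonneg j (b := L) (by omega)
  have h1 := Int.emod_lt_of_pos j (b := L) (by omega)
  refine ⟨j / L, (j % L).toNat, by omega, ?_⟩
  rw [Int.toNat_of_nonneg h0]
  exact (Int.ediv_mul_add_emod j L).symm

theorem concat_step (hL : 0 < L) (β : ℤ → Fin N) (j : ℤ) :
    A (H.concat β j) (H.concat β (j + 1)) = 1 := by
  obtain ⟨k, i, hi, rfl⟩ := exists_eq_mul_add hL j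
  rw [H.concat_apply β k hi]
  by_cases h : i + 1 < L
  · have := H.concat_apply β k h
    push_cast at this
    rw [add_assoc, this]
    exact H.step _ _ h
  · have := H.concat_apply β (k + 1) hL
    rw [show (k * L + i + 1 : ℤ) = (k + 1) * L + (0 : ℕ) by
      rw [show (L : ℤ) = i + 1 by omega]; push_cast; ring, this, show i = L - 1 by omega]
    exact H.glue _ _

/-- Concatenations differ only inside the blocks whose labels differ. -/
theorem concat_eq_concat (hL : 0 < L) {β γ : ℤ → Fin N} {p j : ℤ} (h : ∀ k ≠ p, β k = γ k)
    (hj : j < p * L ∨ (p + 1) * L ≤ j) : H.concat β j = H.concat γ j := by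
  obtain ⟨k, i, hi, rfl⟩ := exists_eq_mul_add hL j
  rw [H.concat_apply β k hi, H.concat_apply γ k hi, h k]
  rintro rfl
  rcases hj with hj | hj
  · omega
  · rw [add_mul] at hj
    omega

theorem label_eq_of_concat_eq {β γ : ℤ → Fin N} {k : ℤ}
    (h : ∀ i < L, H.concat β (k * L + i) = H.concat γ (k * L + i)) : β k = γ k :=
  H.injective _ _ fun i hi => by
    have := h i hi
    rwa [H.concat_apply β k hi, H.concat_apply γ k hi] at this

/-- Concatenation as a point of the two-sided shift. -/
def toTwoSided (hL : 0 < L) (q : ℝ) (β : ℤ → Fin N) : TwoSidedShift A q :=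
  ⟨H.concat β, H.concat_step hL β⟩

/-- Concatenation as a point of the one-sided shift. -/
def toOneSided (hL : 0 < L) (q : ℝ) (β : ℤ → Fin N) : OneSidedShift A q :=
  ⟨fun j => H.concat β j, fun j => by exact_mod_cast H.concat_step hL β j⟩

/-- The label of a block, if it is one of the words. -/
noncomputable def label [NeZero N] (v : Fin L → ι) : Fin N :=
  Function.invFun (fun (b : Fin N) (i : Fin L) => H.word b i) v

theorem label_concat [NeZero N] (β : ℤ → Fin N) (k : ℤ) :
    H.label (fun i => H.concat β (k * L + (i : ℕ))) = β k := by
  have h : Function.Injective fun (b : Fin N) (i : Fin L) => H.word b i := fun b c hbc =>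
    H.injective b c fun i hi => congrFun hbc ⟨i, hi⟩
  have h1 : (fun i : Fin L => H.concat β (k * L + (i : ℕ))) = fun i : Fin L => H.word (β k) i :=
    funext fun i => H.concat_apply β k i.2
  rw [h1]
  exact Function.leftInverse_invFun h (β k)

end Horseshoe

/-! ### Entropy, dimension and expansivity estimates in metric spaces -/

section Estimates

/-- One point from each nonempty fibre of `π` gives a dynamical cover. `C` may depend on `ε` but not
on `n`, so it does not affect the growth rate. -/
theorem coverEntropy_le_of_codings.{u} {X : Type u} [MetricSpace X] {f : X → X} {t : ℝ}
    (h : ∀ ε : ℝ, 0 < ε → ∃ C : ℝ, ∀ᶠ n : ℕ in atTop, ∃ (T : Type u) (_ : Fintype T) (π : X → T),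
      (∀ x y, π x = π y → ∀ k < n, dist (f^[k] x) (f^[k] y) < ε) ∧
        (Fintype.card T : ℝ) ≤ C * Real.exp (t * n)) :
    Dynamics.coverEntropy f Set.univ ≤ (t : EReal) := by
  rw [Dynamics.coverEntropy_eq_iSup_basis Metric.uniformity_basis_dist]
  refine iSup₂_le fun ε hε => ?_
  obtain ⟨C, hC⟩ := h ε hε
  rw [← ExpGrowth.expGrowthSup_exp (a := (t : EReal))]
  refine ExpGrowth.expGrowthSup_le_of_eventually_le (b := ENNReal.ofReal C)
    ENNReal.ofReal_ne_top ?_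
  filter_upwards [hC] with n ⟨T, _, π, hπ, hcard⟩
  classical
  rcases isEmpty_or_nonempty X with hX | hX
  · simp [Set.univ_eq_empty_iff.2 hX]
  have hcov : Dynamics.IsDynCoverOf f Set.univ {p : X × X | dist p.1 p.2 < ε} n
      ((Finset.univ.image (Function.invFun π) : Finset X) : Set X) := by
    intro x _
    refine ⟨Function.invFun π (π x), by simp, ?_⟩
    exact Dynamics.mem_dynEntourage.2 (hπ _ _ (Function.invFun_eq ⟨x, rfl⟩).symm)
  have h1 : ((Dynamics.coverMincard f Set.univ {p : X × X | dist p.1 p.2 < ε} n : ℕ∞) : ℝ≥0∞) ≤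
      ((Fintype.card T : ℕ∞) : ℝ≥0∞) :=
    ENat.toENNReal_le.2 (hcov.coverMincard_le_card.trans
      (Nat.cast_le.2 (Finset.card_image_le.trans_eq Finset.card_univ)))
  refine h1.trans ?_
  have h2 : EReal.exp ((t : EReal) * (n : EReal)) = ENNReal.ofReal (Real.exp (t * n)) := by
    rw [← EReal.exp_coe, EReal.coe_mul, EReal.coe_coe_eq_natCast]
  rw [h2, ← ENNReal.ofReal_mul' (Real.exp_pos _).le]
  refine le_trans (le_of_eq ?_) (ENNReal.ofReal_le_ofReal hcard)
  simp

/-- Points at distance at least `1` have disjoint dynamical balls of radius `1/2`, so the `Nⁿ`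
points form a net. Times that are multiples of `L` suffice because the growth rate is a limsup. -/
theorem le_coverEntropy_of_separated {X : Type*} [MetricSpace X] {f : X → X} {s : ℝ} {L N : ℕ}
    (hL : 0 < L) (hN : Real.exp (s * L) ≤ N)
    (h : ∀ n : ℕ, ∃ p : (Fin n → Fin N) → X, ∀ β γ, β ≠ γ →
      ∃ k < n * L, 1 ≤ dist (f^[k] (p β)) (f^[k] (p γ))) :
    (s : EReal) ≤ Dynamics.coverEntropy f Set.univ := by
  have hU : {p : X × X | dist p.1 p.2 < 1 / 2} ∈ uniformity X :=
    Metric.dist_mem_uniformity (by norm_num)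
  refine le_trans ?_ (Dynamics.netEntropyEntourage_le_coverEntropy f Set.univ hU)
  refine Frequently.le_expGrowthSup ?_
  rw [frequently_atTop]
  intro n
  refine ⟨n * L, Nat.le_mul_of_pos_right n hL, ?_⟩
  obtain ⟨p, hp⟩ := h n
  classical
  have hinj : Function.Injective p := fun β γ hβγ => by
    by_contra hne
    obtain ⟨k, _, hk⟩ := hp β γ hne
    rw [hβγ, dist_self] at hk
    linarith
  have hnet : Dynamics.IsDynNetIn f Set.univ {p : X × X | dist p.1 p.2 < 1 / 2} (n * L)
      ((Finset.univ.image p : Finset X) : Set X) := by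
    refine ⟨Set.subset_univ _, ?_⟩
    intro x hx y hy hxy
    simp only [Finset.coe_image, Finset.coe_univ, Set.image_univ, Set.mem_range] at hx hy
    obtain ⟨β, rfl⟩ := hx
    obtain ⟨γ, rfl⟩ := hy
    obtain ⟨k, hk, hk1⟩ := hp β γ fun e => hxy (e ▸ rfl)
    refine Set.disjoint_left.2 fun z hz hz' => ?_
    have h1 : dist (f^[k] (p β)) (f^[k] z) < 1 / 2 := Dynamics.mem_ball_dynEntourage.1 hz k hk
    have h2 : dist (f^[k] (p γ)) (f^[k] z) < 1 / 2 := Dynamics.mem_ball_dynEntourage.1 hz' k hk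
    have h3 := dist_triangle_right (f^[k] (p β)) (f^[k] (p γ)) (f^[k] z)
    linarith
  have h1 := ENat.toENNReal_le.2 hnet.card_le_netMaxcard
  rw [Finset.card_image_of_injective _ hinj, Finset.card_univ, Fintype.card_fun] at h1
  refine le_trans ?_ h1
  have h2 : EReal.exp ((s : EReal) * ((n * L : ℕ) : EReal)) =
      ENNReal.ofReal (Real.exp (s * (n * L : ℕ))) := by
    rw [← EReal.exp_coe, EReal.coe_mul, EReal.coe_coe_eq_natCast]
  rw [h2]
  have h3 : Real.exp (s * (n * L : ℕ)) ≤ (N : ℝ) ^ n := by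
    rw [show s * ((n * L : ℕ) : ℝ) = n * (s * L) by push_cast; ring, Real.exp_nat_mul]
    exact pow_le_pow_left₀ (Real.exp_pos _).le hN n
  refine (ENNReal.ofReal_le_ofReal h3).trans (le_of_eq ?_)
  simp

open MeasureTheory in
-- The fibres cover `X` with diameters at most `q⁻ⁿ`. At exponent `t / log q` each contributes at
-- most `e^{-tn}`, so the sums stay below `C` and the Hausdorff measure is finite.
theorem dimH_le_of_codings {X : Type*} [MetricSpace X] {q t C : ℝ} (hq : 1 < q) (ht : 0 ≤ t)
    (T : ℕ → Type*) [∀ n, Fintype (T n)] (π : ∀ n, X → T n)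
    (hπ : ∀ n x y, π n x = π n y → dist x y ≤ q ^ (-(n : ℤ)))
    (hcard : ∀ᶠ n : ℕ in atTop, (Fintype.card (T n) : ℝ) ≤ C * Real.exp (t * n)) :
    dimH (Set.univ : Set X) ≤ ENNReal.ofReal (t / Real.log q) := by
  borelize X
  have hlog := Real.log_pos hq
  have hd : 0 ≤ t / Real.log q := div_nonneg ht hlog.le
  have hdiam : ∀ n (i : T n), Metric.ediam (π n ⁻¹' {i}) ≤ ENNReal.ofReal (q ^ (-(n : ℤ))) :=
    fun n i => Metric.ediam_le_of_forall_dist_le fun x hx y hy =>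
      hπ n x y (Eq.trans hx (Eq.symm hy))
  have hr : Tendsto (fun n : ℕ => ENNReal.ofReal (q ^ (-(n : ℤ)))) atTop (𝓝 0) := by
    rw [← ENNReal.ofReal_zero]
    refine ENNReal.tendsto_ofReal ?_
    simpa [Function.comp_def] using
      tendsto_inv_atTop_zero.comp (tendsto_pow_atTop_atTop_of_one_lt hq)
  have hle := Measure.hausdorffMeasure_le_liminf_sum (t / Real.log q) (Set.univ : Set X)
    (l := atTop) _ hr (fun n i => π n ⁻¹' {i}) (Eventually.of_forall hdiam)
    (Eventually.of_forall fun n x _ => Set.mem_iUnion.2 ⟨π n x, rfl⟩)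
  have hbound : liminf (fun n => ∑ i : T n, Metric.ediam (π n ⁻¹' {i}) ^ (t / Real.log q)) atTop ≤
      ENNReal.ofReal C := by
    refine liminf_le_of_frequently_le' (Eventually.frequently ?_)
    filter_upwards [hcard] with n hn
    have hpow : ENNReal.ofReal (q ^ (-(n : ℤ))) ^ (t / Real.log q) =
        ENNReal.ofReal (Real.exp (-(t * n))) := by
      rw [ENNReal.ofReal_rpow_of_nonneg (by positivity) hd]
      congr 1
      rw [← Real.rpow_intCast, ← Real.rpow_mul (by positivity), Real.rpow_def_of_pos (by positivity)]
      congr 1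
      push_cast
      field_simp
    calc ∑ i : T n, Metric.ediam (π n ⁻¹' {i}) ^ (t / Real.log q)
        ≤ ∑ i : T n, ENNReal.ofReal (Real.exp (-(t * n))) := Finset.sum_le_sum fun i _ => by
          rw [← hpow]
          exact ENNReal.rpow_le_rpow (hdiam n i) hd
      _ = ENNReal.ofReal (Fintype.card (T n) * Real.exp (-(t * n))) := by
          rw [Finset.sum_const, Finset.card_univ, nsmul_eq_mul, ENNReal.ofReal_mul (by positivity),
            ENNReal.ofReal_natCast]
      _ ≤ ENNReal.ofReal C := by
          refine ENNReal.ofReal_le_ofReal ?_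
          calc _ ≤ C * Real.exp (t * n) * Real.exp (-(t * n)) :=
                mul_le_mul_of_nonneg_right hn (Real.exp_pos _).le
            _ = C := by rw [mul_assoc, ← Real.exp_add]; simp
  have := dimH_le_of_hausdorffMeasure_ne_top (d := (t / Real.log q).toNNReal) (s := Set.univ)
    (X := X) (by
      rw [Real.coe_toNNReal _ hd]
      exact ne_top_of_le_ne_top ENNReal.ofReal_ne_top (hle.trans hbound))
  exact this

/-- If `X` is coded onto `d` sequences of `N` digits so that points at distance `q ^ (-m)` share
their first `m / L - 2` digits, then `dim X ≥ d log N / (L log q)`. -/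
theorem le_dimH_of_digits {X : Type*} [MetricSpace X] {q : ℝ} (hq : 1 < q) {d L N : ℕ}
    (hL : 0 < L) (hN : 1 < N) (D : X → Fin d → ℕ → Fin N) (hsurj : Function.Surjective D)
    (hD : ∀ x y, x ≠ y → ∃ m : ℕ, dist x y = q ^ (-(m : ℤ)) ∧
      ∀ i k, (k + 2) * L ≤ m → D x i k = D y i k) :
    ENNReal.ofReal (d * (Real.log N / (L * Real.log q))) ≤ dimH (Set.univ : Set X) := by
  have hlogq := Real.log_pos hq
  have hN1 : (1 : ℝ) < N := by exact_mod_cast hN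
  have hlogN := Real.log_pos hN1
  have hL0 : (0 : ℝ) < L := by exact_mod_cast hL
  set r : ℝ := Real.log N / (L * Real.log q) with hr
  have hr0 : 0 < r := by positivity
  let f : X → Fin d → ℝ := fun x i => Real.ofDigits (D x i)
  -- The exponent makes `(q ^ (-m)) ^ r` equal to `N ^ (-m / L)`. The constant `N²` pays for the
  -- digits lost: one in the margin, and less than one in rounding `m / L` down.
  have hf : HolderWith ((N : NNReal) ^ 2) r.toNNReal f := by
    intro x y
    by_cases hxy : x = y
    · simp [hxy]
    obtain ⟨m, hm, hag⟩ := hD x y hxy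
    have hdist : dist (f x) (f y) ≤ (N : ℝ) ^ 2 * dist x y ^ r := by
      refine (dist_pi_le_iff (by positivity)).2 fun i => ?_
      have h1 : |f x i - f y i| ≤ ((N : ℝ) ^ (m / L - 1))⁻¹ :=
        Real.abs_ofDigits_sub_ofDigits_le fun k hk => hag i k <| by
          have : (k + 2) ≤ m / L := by omega
          exact (Nat.mul_le_mul_right L this).trans (Nat.div_mul_le_self m L)
      rw [Real.dist_eq]
      refine h1.trans ?_
      have h2 : dist x y ^ r = Real.exp (-(m / L * Real.log N)) := by
        rw [hm, ← Real.rpow_intCast, ← Real.rpow_mul (by positivity),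
          Real.rpow_def_of_pos (by positivity), hr]
        congr 1
        push_cast
        field_simp
      have h3 : (m : ℝ) / L ≤ ((m / L - 1 : ℕ) : ℝ) + 2 := by
        have h4 : (m : ℝ) / L < (m / L : ℕ) + 1 := by
          rw [div_lt_iff₀ hL0]
          exact_mod_cast Nat.lt_mul_of_div_lt (Nat.lt_succ_self _) hL
        have h5 : ((m / L : ℕ) : ℝ) ≤ ((m / L - 1 : ℕ) : ℝ) + 1 := by
          exact_mod_cast (by omega : m / L ≤ m / L - 1 + 1)
        linarith
      have h6 : ∀ k : ℕ, (N : ℝ) ^ k = Real.exp (k * Real.log N) := fun k => by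
        rw [Real.exp_nat_mul, Real.exp_log (by positivity)]
      rw [h2, h6, h6, ← Real.exp_neg, ← Real.exp_add, Real.exp_le_exp]
      push_cast
      nlinarith
    have hcoe : ((r.toNNReal : NNReal) : ℝ) = r := Real.coe_toNNReal r hr0.le
    rw [edist_dist, edist_dist, hcoe, ENNReal.ofReal_rpow_of_nonneg dist_nonneg hr0.le]
    refine (ENNReal.ofReal_le_ofReal hdist).trans (le_of_eq ?_)
    rw [ENNReal.ofReal_mul (by positivity), ENNReal.ofReal_pow (by positivity)]
    simp
  -- Every number in `[0, 1]` has a base-`N` expansion, so `f` covers a cube of dimension `d`.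
  have hrange : Set.Icc (0 : Fin d → ℝ) 1 ⊆ Set.range f := by
    intro v hv
    have h1 : ∀ i, ∃ δ : ℕ → Fin N, Real.ofDigits δ = v i := fun i => by
      obtain ⟨δ, -, hδ⟩ := Real.ofDigits_SurjOn hN (show v i ∈ Set.Icc (0 : ℝ) 1 from
        ⟨hv.1 i, hv.2 i⟩)
      exact ⟨δ, hδ⟩
    choose δ hδ using h1
    obtain ⟨x, hx⟩ := hsurj δ
    exact ⟨x, funext fun i => by simp only [f, hx, hδ]⟩
  have hcube : dimH (Set.Icc (0 : Fin d → ℝ) 1) = d := by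
    have hmem : Set.Icc (0 : Fin d → ℝ) 1 ∈ 𝓝 (fun _ => 1 / 2 : Fin d → ℝ) := by
      rw [← Set.pi_univ_Icc]
      exact set_pi_mem_nhds Set.finite_univ fun i _ => Icc_mem_nhds (by simp) (by norm_num)
    rw [Real.dimH_of_mem_nhds hmem]
    simp
  have hr1 : 0 < r.toNNReal := Real.toNNReal_pos.2 hr0
  have h1 : (d : ℝ≥0∞) ≤ dimH (Set.univ : Set X) / r.toNNReal :=
    hcube ▸ (dimH_mono hrange).trans (hf.dimH_range_le hr1)
  rw [ENNReal.le_div_iff_mul_le (Or.inl (by exact_mod_cast hr1.ne')) (Or.inl (by simp))] at h1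
  rw [ENNReal.ofReal_mul (by positivity), ENNReal.ofReal_natCast]
  exact h1

theorem tendsto_neg_log_div {g : ℕ → ℝ≥0∞} {c K : ℝ}
    (h1 : ∀ᶠ n : ℕ in atTop, ENNReal.ofReal (Real.exp (-(c * n + K))) ≤ g n)
    (h2 : ∀ᶠ n : ℕ in atTop, g n ≤ ENNReal.ofReal (Real.exp (-(c * n - K)))) :
    Tendsto (fun n : ℕ => -ENNReal.log (g n) / (n : EReal)) atTop (𝓝 (c : EReal)) := by
  have hlim : ∀ K : ℝ, Tendsto (fun n : ℕ => (((c * n + K) / n : ℝ) : EReal)) atTop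
      (𝓝 (c : EReal)) := fun K => by
    refine (continuous_coe_real_ereal.tendsto c).comp ?_
    have h3 : Tendsto (fun n : ℕ => c + K / n) atTop (𝓝 (c + 0)) :=
      tendsto_const_nhds.add (tendsto_const_div_atTop_nhds_zero_nat K)
    rw [add_zero] at h3
    refine h3.congr' ?_
    filter_upwards [eventually_gt_atTop 0] with n hn
    field_simp
  have hlog : ∀ a : ℝ, ENNReal.log (ENNReal.ofReal (Real.exp a)) = (a : EReal) := fun a => by
    rw [ENNReal.log_ofReal_of_pos (Real.exp_pos _), Real.log_exp]
  refine tendsto_of_tendsto_of_tendsto_of_le_of_le' (hlim (-K)) (hlim K) ?_ ?_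
  · filter_upwards [h2] with n hn
    rw [EReal.coe_div, EReal.coe_coe_eq_natCast]
    refine EReal.div_le_div_right_of_nonneg (by positivity) ?_
    rw [EReal.le_neg, ← EReal.coe_neg, ← sub_eq_add_neg, ← hlog]
    exact ENNReal.log_le_log hn
  · filter_upwards [h1] with n hn
    rw [EReal.coe_div, EReal.coe_coe_eq_natCast]
    refine EReal.div_le_div_right_of_nonneg (by positivity) ?_
    rw [EReal.neg_le, ← EReal.coe_neg, ← hlog]
    exact ENNReal.log_le_log hn

end Estimates

/-! ### Growth rates determine dimension and entropy -/

section Limits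

/-- Let `t` decrease and `s` increase to `l`. Lower bounds for positive `s` are enough, since at `l
= 0` there is nothing to prove from below. -/
theorem eq_ofReal_mul_of_forall {D : ℝ≥0∞} {l c : ℝ} (hl : 0 ≤ l)
    (h1 : ∀ t, l < t → D ≤ ENNReal.ofReal (c * t))
    (h2 : ∀ s, 0 < s → s < l → ENNReal.ofReal (c * s) ≤ D) : D = ENNReal.ofReal (c * l) := by
  have hcont : Continuous fun t : ℝ => ENNReal.ofReal (c * t) :=
    ENNReal.continuous_ofReal.comp (by fun_prop)
  refine le_antisymm ?_ ?_
  · exact ge_of_tendsto (hcont.continuousWithinAt (s := Set.Ioi l) (x := l))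
      (eventually_mem_nhdsWithin.mono fun t ht => h1 t ht)
  · rcases hl.eq_or_lt with rfl | hl
    · simp
    · refine le_of_tendsto (hcont.continuousWithinAt (s := Set.Iio l) (x := l)) ?_
      filter_upwards [Ioo_mem_nhdsLT hl] with s hs using h2 s hs.1 hs.2

theorem eq_coe_of_forall {E : EReal} {l : ℝ} (hl : 0 ≤ l) (h0 : 0 ≤ E)
    (h1 : ∀ t : ℝ, l < t → E ≤ t) (h2 : ∀ s : ℝ, 0 < s → s < l → (s : EReal) ≤ E) :
    E = l := by
  have hcont : Continuous fun t : ℝ => (t : EReal) := continuous_coe_real_ereal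
  refine le_antisymm ?_ ?_
  · exact ge_of_tendsto (hcont.continuousWithinAt (s := Set.Ioi l) (x := l))
      (eventually_mem_nhdsWithin.mono fun t ht => h1 t ht)
  · rcases hl.eq_or_lt with rfl | hl
    · exact h0
    · refine le_of_tendsto (hcont.continuousWithinAt (s := Set.Iio l) (x := l)) ?_
      filter_upwards [Ioo_mem_nhdsLT hl] with s hs using h2 s hs.1 hs.2

open Classical in
theorem eventually_card_isAdmissible_le {ι : Type*} [Fintype ι] [DecidableEq ι]
    {A : Matrix ι ι ℝ} (hA : ∀ i j, A i j = 0 ∨ A i j = 1) (h : ∀ n, 1 ≤ ‖A ^ n‖) {l t : ℝ}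
    (hl : Tendsto (fun k : ℕ => 1 / (k : ℝ) * Real.log ‖A ^ k‖) atTop (𝓝 l)) (ht : l < t) :
    ∀ᶠ n : ℕ in atTop, (Fintype.card {w : Fin (n + 1) → ι // IsAdmissible A w} : ℝ) ≤
      Fintype.card ι * Real.exp (t * n) := by
  filter_upwards [hl.eventually_lt_const ht, eventually_gt_atTop 0] with n hn hn0
  refine (card_isAdmissible_le hA n).trans (mul_le_mul_of_nonneg_left ?_ (Nat.cast_nonneg _))
  rw [← Real.log_le_iff_le_exp (by linarith [h n])]
  have : (0 : ℝ) < n := by exact_mod_cast hn0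
  rw [one_div, inv_mul_eq_div, div_lt_iff₀ this] at hn
  exact hn.le

theorem zpow_neg_eq_exp {q : ℝ} (hq : 1 < q) (m : ℕ) :
    q ^ (-(m : ℤ)) = Real.exp (-(m * Real.log q)) := by
  rw [← Real.rpow_intCast, Real.rpow_def_of_pos (by positivity)]
  congr 1
  push_cast
  ring

theorem limsup_liminf_eq_of_sandwich {g : ℕ → ℝ≥0∞} {c K : ℝ}
    (h1 : ∀ᶠ n : ℕ in atTop, ENNReal.ofReal (Real.exp (-(c * n + K))) ≤ g n)
    (h2 : ∀ᶠ n : ℕ in atTop, g n ≤ ENNReal.ofReal (Real.exp (-(c * n - K)))) :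
    limsup (fun n : ℕ => -ENNReal.log (g n) / (n : EReal)) atTop = c ∧
      liminf (fun n : ℕ => -ENNReal.log (g n) / (n : EReal)) atTop = c :=
  ⟨(tendsto_neg_log_div h1 h2).limsup_eq, (tendsto_neg_log_div h1 h2).liminf_eq⟩

end Limits

namespace Horseshoe

variable {ι : Type*} {A : Matrix ι ι ℝ} {L N : ℕ} (H : Horseshoe A L N)

theorem exists_concat_ne {β γ : ℤ → Fin N} {k : ℤ} (h : β k ≠ γ k) :
    ∃ i < L, H.concat β (k * L + (i : ℕ)) ≠ H.concat γ (k * L + (i : ℕ)) := by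
  by_contra! hcon
  exact h (H.label_eq_of_concat_eq fun i hi => hcon i hi)

/-- Some block with nonnegative index fits into a gap of length `2 * L` after position `m`. -/
theorem exists_block (hL : 0 < L) (m : ℕ) :
    ∃ p : ℕ, (m : ℤ) + 1 ≤ p * L ∧ ((p : ℤ) + 1) * L ≤ m + 2 * L := by
  refine ⟨m / L + 1, ?_, ?_⟩
  · have := Nat.lt_mul_of_div_lt (Nat.lt_succ_self (m / L)) hL
    rw [mul_comm] at this
    have h2 : m + 1 ≤ (m / L + 1) * L := by rw [mul_comm]; linarith
    exact_mod_cast h2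
  · have := Nat.div_mul_le_self m L
    have h2 : (m / L + 1 + 1) * L ≤ m + 2 * L := by linarith
    exact_mod_cast h2

end Horseshoe

/-! ### The one-sided shift -/

namespace OneSidedShift

variable {ι : Type*} {A : Matrix ι ι ℝ} {q : ℝ} [hq : Fact (1 < q)]

theorem dist_le {x y : OneSidedShift A q} {m : ℕ} (h : ∀ j < m, x.1 j = y.1 j) :
    dist x y ≤ q ^ (-(m : ℤ)) :=
  seqDist_le_of_agree (size := id) hq.out h

theorem eq_of_dist_lt {x y : OneSidedShift A q} {m : ℕ} (h : dist x y < q ^ (-(m : ℤ))) {j : ℕ}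
    (hj : j ≤ m) : x.1 j = y.1 j :=
  agree_of_seqDist_lt (size := id) hq.out h hj

omit hq in
theorem iterate_apply (n : ℕ) (x : OneSidedShift A q) (j : ℕ) :
    ((oneSidedShiftMap A q)^[n] x).1 j = x.1 (j + n) := by
  induction n generalizing x with
  | zero => rfl
  | succ n ih =>
    rw [Function.iterate_succ_apply, ih]
    exact congrArg x.1 (by omega)

omit hq in
theorem iterate_iterate_apply (n k : ℕ) (x : OneSidedShift A q) (j : ℕ) :
    (((oneSidedShiftMap A q)^[n])^[k] x).1 j = x.1 (j + n * k) := by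
  rw [← Function.iterate_mul, iterate_apply]

/-- The word of `x` at the positions `0, …, n`. -/
def window (n : ℕ) (x : OneSidedShift A q) : {w : Fin (n + 1) → ι // IsAdmissible A w} :=
  ⟨fun i => x.1 i, fun k => x.2 k⟩

omit hq in
theorem eq_of_window_eq {n : ℕ} {x y : OneSidedShift A q} (h : window n x = window n y) {j : ℕ}
    (hj : j ≤ n) : x.1 j = y.1 j :=
  congrFun (congrArg Subtype.val h) ⟨j, Nat.lt_succ_of_le hj⟩

/-- The windows `[nk, nk + n - 1]` tile `ℕ`. -/
theorem isExpansiveConstMap {n : ℕ} (hn : 0 < n) :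
    IsExpansiveConstMap ((oneSidedShiftMap A q)^[n]) (q ^ (-((n - 1 : ℕ) : ℤ))) := by
  have hq1 := hq.out
  refine ⟨by positivity, fun x y h => Subtype.ext (funext fun p => ?_)⟩
  have h1 := eq_of_dist_lt (h (p / n)) (j := p % n) (by have := Nat.mod_lt p hn; omega)
  rwa [iterate_iterate_apply, iterate_iterate_apply, Nat.mod_add_div] at h1

theorem isExpansiveMap : IsExpansiveMap (oneSidedShiftMap A q) :=
  ⟨_, isExpansiveConstMap (n := 1) one_pos⟩

/-- Two concatenations that differ in one block placed between `m` and `n` agree on every window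
`[nk, nk + m]`, yet are distinct; a larger `c` would identify them. -/
theorem le_zpow_of_isExpansiveConstMap {L N : ℕ} (H : Horseshoe A L N) (hL : 0 < L) (hN : 1 < N)
    {n m : ℕ} (hn : m + 2 * L + 1 ≤ n) {c : ℝ}
    (hc : IsExpansiveConstMap ((oneSidedShiftMap A q)^[n]) c) : c ≤ q ^ (-((m + 1 : ℕ) : ℤ)) := by
  by_contra! hlt
  obtain ⟨p, hp1, hp2⟩ := Horseshoe.exists_block hL m
  let β : ℤ → Fin N := fun _ => ⟨0, by omega⟩
  let γ : ℤ → Fin N := Function.update β p ⟨1, hN⟩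
  have hβγ : ∀ k ≠ (p : ℤ), β k = γ k := fun k hk => (Function.update_of_ne hk _ _).symm
  have hne : β p ≠ γ p := by simp [β, γ]
  have heq := hc.2 (H.toOneSided hL q β) (H.toOneSided hL q γ) fun k => by
    refine (dist_le fun j hj => ?_).trans_lt hlt
    rw [iterate_iterate_apply, iterate_iterate_apply]
    refine H.concat_eq_concat hL hβγ ?_
    push_cast
    rcases Nat.eq_zero_or_pos k with rfl | hk
    · left
      simp only [Nat.cast_zero, mul_zero, add_zero]
      omega
    · right
      have : (n : ℤ) * 1 ≤ n * k := mul_le_mul_of_nonneg_left (by omega) (by omega)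
      omega
  obtain ⟨i, hi, hne'⟩ := H.exists_concat_ne hne
  refine hne' ?_
  have := congrFun (congrArg Subtype.val heq) (p * L + i)
  exact_mod_cast this

theorem expansiveDecayMap_eq {L N : ℕ} (H : Horseshoe A L N) (hL : 0 < L) (hN : 1 < N) :
    upperExpansiveDecayMap (oneSidedShiftMap A q) = ((Real.log q : ℝ) : EReal) ∧
      lowerExpansiveDecayMap (oneSidedShiftMap A q) = ((Real.log q : ℝ) : EReal) := by
  have hlog := Real.log_pos hq.out
  refine limsup_liminf_eq_of_sandwich (K := (2 * L + 1) * Real.log q) ?_ ?_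
  · filter_upwards [eventually_gt_atTop 0] with n hn
    refine le_trans (ENNReal.ofReal_le_ofReal ?_)
      (le_iSup₂_of_le _ (isExpansiveConstMap hn) le_rfl)
    rw [zpow_neg_eq_exp hq.out, Real.exp_le_exp]
    have : ((n - 1 : ℕ) : ℝ) ≤ n := by exact_mod_cast Nat.sub_le n 1
    have : (0 : ℝ) ≤ L := Nat.cast_nonneg L
    nlinarith
  · filter_upwards [eventually_ge_atTop (2 * L + 1)] with n hn
    refine iSup₂_le fun c hc => ENNReal.ofReal_le_ofReal ?_
    refine (le_zpow_of_isExpansiveConstMap H hL hN (m := n - (2 * L + 1)) (by omega) hc).trans ?_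
    rw [zpow_neg_eq_exp hq.out, Real.exp_le_exp]
    push_cast [Nat.cast_sub hn]
    nlinarith

theorem le_coverEntropy {s : ℝ} {L N : ℕ} [NeZero N] (H : Horseshoe A L N) (hL : 0 < L)
    (hN : Real.exp (s * L) ≤ N) :
    (s : EReal) ≤ Dynamics.coverEntropy (oneSidedShiftMap A q) Set.univ := by
  refine le_coverEntropy_of_separated hL hN fun n => ?_
  -- Only the labels `0, …, n - 1` matter; negative blocks repeat the first label because `toNat`
  -- sends them to `0`.
  let ext : (Fin n → Fin N) → ℤ → Fin N := fun β k =>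
    if h : k.toNat < n then β ⟨k.toNat, h⟩ else 0
  refine ⟨fun β => H.toOneSided hL q (ext β), fun β γ hβγ => ?_⟩
  obtain ⟨k, hk⟩ := Function.ne_iff.1 hβγ
  obtain ⟨i, hi, hne⟩ := H.exists_concat_ne (β := ext β) (γ := ext γ) (k := (k : ℕ))
    (by simpa [ext] using hk)
  -- The time at which the disagreement reaches position `0`, where it forces distance `1`.
  refine ⟨k * L + i, ?_, ?_⟩
  · calc (k : ℕ) * L + i < k * L + L := by omega
      _ = (k + 1) * L := by ring
      _ ≤ n * L := Nat.mul_le_mul_right L k.2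
  · by_contra! hlt
    have h1 := eq_of_dist_lt (m := 0) (by simpa using hlt) (le_refl 0)
    rw [iterate_apply, iterate_apply, zero_add] at h1
    refine hne ?_
    have h2 : H.concat (ext β) ((k * L + i : ℕ) : ℤ) = H.concat (ext γ) ((k * L + i : ℕ) : ℤ) := h1
    exact_mod_cast h2

theorem le_dimH {L N : ℕ} (H : Horseshoe A L N) (hL : 0 < L) (hN : 1 < N) :
    ENNReal.ofReal (Real.log N / (L * Real.log q)) ≤
      dimH (Set.univ : Set (OneSidedShift A q)) := by
  have : NeZero N := ⟨by omega⟩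
  have key := le_dimH_of_digits (X := OneSidedShift A q) (d := 1) hq.out hL hN
    (fun x _ k => H.label fun i => x.1 (k * L + i)) (fun δ => ?_) fun x y hxy => ?_
  · simpa using key
  · refine ⟨H.toOneSided hL q fun k => δ 0 k.toNat, funext fun i => funext fun k => ?_⟩
    have h1 := H.label_concat (fun k => δ 0 k.toNat) (k : ℤ)
    rw [Subsingleton.elim i 0]
    refine Eq.trans ?_ h1
    congr 1
  · obtain ⟨m, hm, hag⟩ := exists_seqDist_eq (size := id) (q := q) fun e => hxy (Subtype.ext e)
    refine ⟨m, hm, fun _ k hk => ?_⟩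
    have h1 : (fun i : Fin L => x.1 (k * L + i)) = fun i : Fin L => y.1 (k * L + i) :=
      funext fun i => hag _ (by have := i.2; simp only [id]; nlinarith)
    simp only [h1]

variable [Fintype ι] [DecidableEq ι]

theorem dimH_eq (hA : ∀ i j, A i j = 0 ∨ A i j = 1) (h : ∀ n, 1 ≤ ‖A ^ n‖) {l : ℝ} (hl0 : 0 ≤ l)
    (hl : Tendsto (fun k : ℕ => 1 / (k : ℝ) * Real.log ‖A ^ k‖) atTop (𝓝 l))
    (hexp : ∀ n : ℕ, Real.exp (l * n) ≤ ‖A ^ n‖) :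
    dimH (Set.univ : Set (OneSidedShift A q)) = ENNReal.ofReal (1 / Real.log q * l) := by
  classical
  have hlog := Real.log_pos hq.out
  refine eq_ofReal_mul_of_forall hl0 (fun t ht => ?_) fun s hs0 hs => ?_
  · have := dimH_le_of_codings (X := OneSidedShift A q) hq.out (hl0.trans ht.le)
      (fun n => {w : Fin (n + 1) → ι // IsAdmissible A w}) window
      (fun n x y hxy => dist_le fun j hj => eq_of_window_eq hxy hj.le)
      (eventually_card_isAdmissible_le hA h hl ht)
    rwa [one_div, inv_mul_eq_div]
  · obtain ⟨L, N, hL, hN, ⟨H⟩⟩ := exists_horseshoe hA hs hexp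
    have hsL : 0 < s * L := by positivity
    have hN1 : (1 : ℝ) < N := (Real.one_lt_exp_iff.2 hsL).trans_le hN
    refine (ENNReal.ofReal_le_ofReal ?_).trans (le_dimH H hL (by exact_mod_cast hN1))
    have := (Real.le_log_iff_exp_le (by linarith)).2 hN
    have hL0 : (0 : ℝ) < L := by exact_mod_cast hL
    rw [one_div, inv_mul_eq_div, div_le_div_iff₀ hlog (by positivity)]
    nlinarith

theorem coverEntropy_eq [Nonempty (OneSidedShift A q)] (hA : ∀ i j, A i j = 0 ∨ A i j = 1)
    (h : ∀ n, 1 ≤ ‖A ^ n‖) {l : ℝ} (hl0 : 0 ≤ l)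
    (hl : Tendsto (fun k : ℕ => 1 / (k : ℝ) * Real.log ‖A ^ k‖) atTop (𝓝 l))
    (hexp : ∀ n : ℕ, Real.exp (l * n) ≤ ‖A ^ n‖) :
    Dynamics.coverEntropy (oneSidedShiftMap A q) Set.univ = l := by
  classical
  refine eq_coe_of_forall hl0 (Dynamics.coverEntropy_nonneg _ Set.univ_nonempty) (fun t ht => ?_)
    fun s hs0 hs => ?_
  · refine coverEntropy_le_of_codings fun ε hε => ?_
    -- Resolution `ε` costs `m` extra letters, hence only the factor `e^{tm}` in the count.
    obtain ⟨m, hm⟩ := exists_pow_lt_of_lt_one hε (inv_lt_one_of_one_lt₀ hq.out)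
    refine ⟨Fintype.card ι * Real.exp (t * m), ?_⟩
    filter_upwards [(tendsto_add_atTop_nat m).eventually
      (eventually_card_isAdmissible_le hA h hl ht)] with n hn
    refine ⟨_, inferInstance, window (n + m), fun x y hxy k hk => ?_, hn.trans_eq ?_⟩
    · refine lt_of_le_of_lt (dist_le (m := m) fun j hj => ?_) (by simpa using hm)
      rw [iterate_apply, iterate_apply]
      exact eq_of_window_eq hxy (by omega)
    · rw [mul_assoc, ← Real.exp_add]
      push_cast
      ring_nf
  · obtain ⟨L, N, hL, hN, ⟨H⟩⟩ := exists_horseshoe hA hs hexp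
    have hN0 : (0 : ℝ) < N := (Real.exp_pos _).trans_le hN
    have : NeZero N := ⟨by rintro rfl; simp at hN0⟩
    exact le_coverEntropy H hL hN

omit hq in
theorem one_le_norm_pow [hne : Nonempty (OneSidedShift A q)]
    (hA : ∀ i j, A i j = 0 ∨ A i j = 1) (n : ℕ) : 1 ≤ ‖A ^ n‖ :=
  _root_.one_le_norm_pow hA (window n hne.some).2

end OneSidedShift

/-! ### The two-sided shift -/

namespace TwoSidedShift

variable {ι : Type*} {A : Matrix ι ι ℝ} {q : ℝ} [hq : Fact (1 < q)]

theorem dist_le {x y : TwoSidedShift A q} {m : ℕ} (h : ∀ j : ℤ, j.natAbs < m → x.1 j = y.1 j) :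
    dist x y ≤ q ^ (-(m : ℤ)) :=
  seqDist_le_of_agree (size := Int.natAbs) hq.out h

theorem eq_of_dist_lt {x y : TwoSidedShift A q} {m : ℕ} (h : dist x y < q ^ (-(m : ℤ))) {j : ℤ}
    (hj : j.natAbs ≤ m) : x.1 j = y.1 j :=
  agree_of_seqDist_lt (size := Int.natAbs) hq.out h hj

theorem iterate_apply (n : ℕ) (x : TwoSidedShift A q) (j : ℤ) :
    ((twoSidedShiftMap A q)^[n] x).1 j = x.1 (j + n) := by
  induction n generalizing x with
  | zero => exact congrArg x.1 (by simp)
  | succ n ih =>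
    rw [Function.iterate_succ_apply, ih]
    exact congrArg x.1 (by push_cast; ring)

theorem zpow_apply (n : ℤ) (x : TwoSidedShift A q) (j : ℤ) :
    ((twoSidedShiftMap A q ^ n) x).1 j = x.1 (j + n) := by
  induction n generalizing x with
  | zero => exact congrArg x.1 (by simp)
  | succ n ih =>
    rw [zpow_add_one, Homeomorph.mul_apply, ih]
    exact congrArg x.1 (by ring)
  | pred n ih =>
    rw [zpow_sub_one, Homeomorph.mul_apply, ih]
    exact congrArg x.1 (by ring)

theorem pow_zpow_apply (n : ℕ) (k : ℤ) (x : TwoSidedShift A q) (j : ℤ) :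
    (((twoSidedShiftMap A q ^ n) ^ k) x).1 j = x.1 (j + n * k) := by
  rw [← zpow_natCast, ← zpow_mul, zpow_apply]

/-- The word of `x` at the positions `p, …, p + n`. -/
def window (p : ℤ) (n : ℕ) (x : TwoSidedShift A q) : {w : Fin (n + 1) → ι // IsAdmissible A w} :=
  ⟨fun i => x.1 (p + (i : ℕ)), fun k => by
    have := x.2 (p + (k : ℕ))
    rw [add_assoc] at this
    exact_mod_cast this⟩

omit hq in
theorem eq_of_window_eq {p : ℤ} {n : ℕ} {x y : TwoSidedShift A q}
    (h : window p n x = window p n y) {j : ℤ} (h1 : p ≤ j) (h2 : j ≤ p + n) : x.1 j = y.1 j := by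
  have := congrFun (congrArg Subtype.val h) ⟨(j - p).toNat, by omega⟩
  have hj : p + ((j - p).toNat : ℤ) = j := by omega
  simpa only [window, hj] using this

/-- The windows of radius `n / 2` centred at multiples of `n` cover `ℤ`, since `n ≤ 2 * (n / 2) +
1`. This is where the two-sided rate is halved. -/
theorem isExpansiveConst {n : ℕ} (hn : 0 < n) :
    IsExpansiveConst (twoSidedShiftMap A q ^ n) (q ^ (-((n / 2 : ℕ) : ℤ))) := by
  have hq1 := hq.out
  refine ⟨by positivity, fun x y h => Subtype.ext (funext fun p => ?_)⟩
  have hn' : (0 : ℤ) < n := by omega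
  have h0 := Int.emod_nonneg (p + (n / 2 : ℕ)) hn'.ne'
  have h2 := Int.emod_lt_of_pos (p + (n / 2 : ℕ)) hn'
  have h3 := Int.emod_add_mul_ediv (p + (n / 2 : ℕ)) n
  have h1 := eq_of_dist_lt (h ((p + (n / 2 : ℕ)) / n))
    (j := (p + (n / 2 : ℕ)) % n - (n / 2 : ℕ)) (by omega)
  have h4 : (p + (n / 2 : ℕ)) % n - (n / 2 : ℕ) + n * ((p + (n / 2 : ℕ)) / n) = p := by linarith
  rwa [pow_zpow_apply, pow_zpow_apply, h4] at h1

theorem isExpansive : IsExpansive (twoSidedShiftMap A q) :=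
  ⟨_, by simpa using isExpansiveConst (A := A) (q := q) (n := 1) one_pos⟩

/-- As on the one-sided space, but the windows now reach `m` to both sides of each multiple of `n`,
so the gap lies between `m` and `n - m`. -/
theorem le_zpow_of_isExpansiveConst {L N : ℕ} (H : Horseshoe A L N) (hL : 0 < L) (hN : 1 < N)
    {n m : ℕ} (hn : 2 * m + 2 * L + 1 ≤ n) {c : ℝ}
    (hc : IsExpansiveConst (twoSidedShiftMap A q ^ n) c) : c ≤ q ^ (-((m + 1 : ℕ) : ℤ)) := by
  by_contra! hlt
  obtain ⟨p, hp1, hp2⟩ := Horseshoe.exists_block hL m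
  let β : ℤ → Fin N := fun _ => ⟨0, by omega⟩
  let γ : ℤ → Fin N := Function.update β p ⟨1, hN⟩
  have hβγ : ∀ k ≠ (p : ℤ), β k = γ k := fun k hk => (Function.update_of_ne hk _ _).symm
  have hne : β p ≠ γ p := by simp [β, γ]
  have heq := hc.2 (H.toTwoSided hL q β) (H.toTwoSided hL q γ) fun k => by
    refine (dist_le fun j hj => ?_).trans_lt hlt
    rw [pow_zpow_apply, pow_zpow_apply]
    refine H.concat_eq_concat hL hβγ ?_
    rcases le_or_gt k 0 with hk | hk
    · left
      have : (n : ℤ) * k ≤ n * 0 := mul_le_mul_of_nonneg_left hk (by omega)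
      omega
    · right
      have : (n : ℤ) * 1 ≤ n * k := mul_le_mul_of_nonneg_left (by omega) (by omega)
      omega
  obtain ⟨i, hi, hne'⟩ := H.exists_concat_ne hne
  exact hne' (congrFun (congrArg Subtype.val heq) (p * L + i))

theorem expansiveDecay_eq {L N : ℕ} (H : Horseshoe A L N) (hL : 0 < L) (hN : 1 < N) :
    upperExpansiveDecay (twoSidedShiftMap A q) = ((Real.log q / 2 : ℝ) : EReal) ∧
      lowerExpansiveDecay (twoSidedShiftMap A q) = ((Real.log q / 2 : ℝ) : EReal) := by
  have hlog := Real.log_pos hq.out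
  refine limsup_liminf_eq_of_sandwich (K := (L + 1) * Real.log q) ?_ ?_
  · filter_upwards [eventually_gt_atTop 0] with n hn
    refine le_trans (ENNReal.ofReal_le_ofReal ?_)
      (le_iSup₂_of_le _ (isExpansiveConst hn) le_rfl)
    rw [zpow_neg_eq_exp hq.out, Real.exp_le_exp]
    have : ((n / 2 : ℕ) : ℝ) ≤ n / 2 := Nat.cast_div_le
    have : (0 : ℝ) ≤ L := Nat.cast_nonneg L
    nlinarith
  · filter_upwards [eventually_ge_atTop (2 * L + 1)] with n hn
    refine iSup₂_le fun c hc => ENNReal.ofReal_le_ofReal ?_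
    refine (le_zpow_of_isExpansiveConst H hL hN (m := (n - (2 * L + 1)) / 2) (by omega) hc).trans ?_
    rw [zpow_neg_eq_exp hq.out, Real.exp_le_exp]
    have : (n : ℝ) ≤ 2 * ((n - (2 * L + 1)) / 2 : ℕ) + 2 * L + 2 := by
      exact_mod_cast (by omega : n ≤ 2 * ((n - (2 * L + 1)) / 2) + 2 * L + 2)
    push_cast
    nlinarith

theorem le_coverEntropy {s : ℝ} {L N : ℕ} [NeZero N] (H : Horseshoe A L N) (hL : 0 < L)
    (hN : Real.exp (s * L) ≤ N) :
    (s : EReal) ≤ Dynamics.coverEntropy (twoSidedShiftMap A q) Set.univ := by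
  refine le_coverEntropy_of_separated hL hN fun n => ?_
  let ext : (Fin n → Fin N) → ℤ → Fin N := fun β k =>
    if h : k.toNat < n then β ⟨k.toNat, h⟩ else 0
  refine ⟨fun β => H.toTwoSided hL q (ext β), fun β γ hβγ => ?_⟩
  obtain ⟨k, hk⟩ := Function.ne_iff.1 hβγ
  obtain ⟨i, hi, hne⟩ := H.exists_concat_ne (β := ext β) (γ := ext γ) (k := (k : ℕ))
    (by simpa [ext] using hk)
  refine ⟨k * L + i, ?_, ?_⟩
  · calc (k : ℕ) * L + i < k * L + L := by omega
      _ = (k + 1) * L := by ring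
      _ ≤ n * L := Nat.mul_le_mul_right L k.2
  · by_contra! hlt
    have h1 := eq_of_dist_lt (m := 0) (by simpa using hlt) (j := 0) (le_refl 0)
    rw [iterate_apply, iterate_apply, zero_add] at h1
    refine hne ?_
    have h2 : H.concat (ext β) ((k * L + i : ℕ) : ℤ) = H.concat (ext γ) ((k * L + i : ℕ) : ℤ) := h1
    exact_mod_cast h2

/-- The blocks to the right and to the left of the origin give two independent digit sequences,
hence a map onto a square; this is the source of the factor `2`. -/
theorem le_dimH {L N : ℕ} (H : Horseshoe A L N) (hL : 0 < L) (hN : 1 < N) :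
    ENNReal.ofReal (2 * (Real.log N / (L * Real.log q))) ≤
      dimH (Set.univ : Set (TwoSidedShift A q)) := by
  have : NeZero N := ⟨by omega⟩
  let pos : Fin 2 → ℕ → ℤ := fun i k => if i = 0 then k else -k - 1
  have key := le_dimH_of_digits (X := TwoSidedShift A q) (d := 2) hq.out hL hN
    (fun x i k => H.label fun r => x.1 (pos i k * L + (r : ℕ))) (fun δ => ?_) fun x y hxy => ?_
  · simpa using key
  · let β : ℤ → Fin N := fun k => if 0 ≤ k then δ 0 k.toNat else δ 1 (-k - 1).toNat
    refine ⟨H.toTwoSided hL q β, funext fun i => funext fun k => ?_⟩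
    refine (H.label_concat β (pos i k)).trans ?_
    fin_cases i
    · simp [β, pos]
    · have h1 : ¬ (0 : ℤ) ≤ -k - 1 := by omega
      have h2 : (-(-(k : ℤ) - 1) - 1).toNat = k := by omega
      change (if (0 : ℤ) ≤ -k - 1 then _ else δ 1 (-(-(k : ℤ) - 1) - 1).toNat) = δ 1 k
      rw [if_neg h1, h2]
  · obtain ⟨m, hm, hag⟩ := exists_seqDist_eq (size := Int.natAbs) (q := q)
      fun e => hxy (Subtype.ext e)
    refine ⟨m, hm, fun i k hk => ?_⟩
    have h1 : (fun r : Fin L => x.1 (pos i k * L + (r : ℕ))) =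
        fun r : Fin L => y.1 (pos i k * L + (r : ℕ)) := funext fun r => hag _ <| by
      have hr := r.2
      have hk' : (k : ℤ) * L + 2 * L ≤ m := by rw [add_mul] at hk; exact_mod_cast hk
      have hkL : (0 : ℤ) ≤ k * L := by positivity
      fin_cases i
      · have h2 : pos 0 k * L = k * L := by simp [pos]
        change (pos 0 k * L + (r : ℕ) : ℤ).natAbs < m
        rw [h2]
        omega
      · have h2 : pos 1 k * L = -(k * L) - L := by simp [pos]; ring
        change (pos 1 k * L + (r : ℕ) : ℤ).natAbs < m
        rw [h2]
        omega
    simp only [h1]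

variable [Fintype ι] [DecidableEq ι]

theorem dimH_eq (hA : ∀ i j, A i j = 0 ∨ A i j = 1) (h : ∀ n, 1 ≤ ‖A ^ n‖) {l : ℝ} (hl0 : 0 ≤ l)
    (hl : Tendsto (fun k : ℕ => 1 / (k : ℝ) * Real.log ‖A ^ k‖) atTop (𝓝 l))
    (hexp : ∀ n : ℕ, Real.exp (l * n) ≤ ‖A ^ n‖) :
    dimH (Set.univ : Set (TwoSidedShift A q)) = ENNReal.ofReal (2 / Real.log q * l) := by
  classical
  have hlog := Real.log_pos hq.out
  refine eq_ofReal_mul_of_forall hl0 (fun t ht => ?_) fun s hs0 hs => ?_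
  · have ht0 : 0 ≤ t := hl0.trans ht.le
    have := dimH_le_of_codings (X := TwoSidedShift A q) (C := Fintype.card ι) hq.out
      (t := 2 * t) (by positivity)
      (fun n => {w : Fin (2 * n + 1) → ι // IsAdmissible A w}) (fun n => window (-n) (2 * n))
      (fun n x y hxy => dist_le fun j hj => eq_of_window_eq hxy (by omega) (by omega))
      (by
        have h2 : Tendsto (fun n : ℕ => 2 * n) atTop atTop :=
          tendsto_id.const_mul_atTop' two_pos
        filter_upwards [h2.eventually (eventually_card_isAdmissible_le hA h hl ht)] with n hn
        refine hn.trans_eq ?_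
        push_cast
        ring_nf)
    rwa [div_mul_eq_mul_div]
  · obtain ⟨L, N, hL, hN, ⟨H⟩⟩ := exists_horseshoe hA hs hexp
    have hsL : 0 < s * L := by positivity
    have hN1 : (1 : ℝ) < N := (Real.one_lt_exp_iff.2 hsL).trans_le hN
    refine (ENNReal.ofReal_le_ofReal ?_).trans (le_dimH H hL (by exact_mod_cast hN1))
    have := (Real.le_log_iff_exp_le (by linarith)).2 hN
    have hL0 : (0 : ℝ) < L := by exact_mod_cast hL
    rw [div_mul_eq_mul_div, mul_div_assoc]
    refine mul_le_mul_of_nonneg_left ?_ two_pos.le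
    rw [div_le_div_iff₀ hlog (by positivity)]
    nlinarith

theorem coverEntropy_eq [Nonempty (TwoSidedShift A q)] (hA : ∀ i j, A i j = 0 ∨ A i j = 1)
    (h : ∀ n, 1 ≤ ‖A ^ n‖) {l : ℝ} (hl0 : 0 ≤ l)
    (hl : Tendsto (fun k : ℕ => 1 / (k : ℝ) * Real.log ‖A ^ k‖) atTop (𝓝 l))
    (hexp : ∀ n : ℕ, Real.exp (l * n) ≤ ‖A ^ n‖) :
    Dynamics.coverEntropy (twoSidedShiftMap A q) Set.univ = l := by
  classical
  refine eq_coe_of_forall hl0 (Dynamics.coverEntropy_nonneg _ Set.univ_nonempty) (fun t ht => ?_)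
    fun s hs0 hs => ?_
  · refine coverEntropy_le_of_codings fun ε hε => ?_
    obtain ⟨m, hm⟩ := exists_pow_lt_of_lt_one hε (inv_lt_one_of_one_lt₀ hq.out)
    refine ⟨Fintype.card ι * Real.exp (t * (2 * m : ℕ)), ?_⟩
    filter_upwards [(tendsto_add_atTop_nat (2 * m)).eventually
      (eventually_card_isAdmissible_le hA h hl ht)] with n hn
    refine ⟨_, inferInstance, window (-m) (n + 2 * m), fun x y hxy k hk => ?_, hn.trans_eq ?_⟩
    · refine lt_of_le_of_lt (dist_le (m := m) fun j hj => ?_) (by simpa using hm)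
      rw [iterate_apply, iterate_apply]
      exact eq_of_window_eq hxy (by omega) (by omega)
    · rw [mul_assoc, ← Real.exp_add]
      push_cast
      ring_nf
  · obtain ⟨L, N, hL, hN, ⟨H⟩⟩ := exists_horseshoe hA hs hexp
    have hN0 : (0 : ℝ) < N := (Real.exp_pos _).trans_le hN
    have : NeZero N := ⟨by rintro rfl; simp at hN0⟩
    exact le_coverEntropy H hL hN

omit hq in
theorem one_le_norm_pow [hne : Nonempty (TwoSidedShift A q)]
    (hA : ∀ i j, A i j = 0 ∨ A i j = 1) (n : ℕ) : 1 ≤ ‖A ^ n‖ :=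
  _root_.one_le_norm_pow hA (window 0 n hne.some).2

end TwoSidedShift

/-- A decay rate equal to `κ` for positive entropy multiplies the dimension `l / κ` to `l`. -/
theorem decay_mul_dimH_eq {u D : EReal} {l κ : ℝ} (hκ : 0 < κ) (hl0 : 0 ≤ l)
    (hD : D = ((1 / κ * l : ℝ) : EReal)) (hu : 0 < l → u = κ) : u * D = l := by
  rcases hl0.eq_or_lt with rfl | hl
  · simp [hD]
  · rw [hD, hu hl, ← EReal.coe_mul]
    congr 1
    field_simp

theorem mainTheorem2 {ι : Type*} [Fintype ι] [DecidableEq ι] (A : Matrix ι ι ℝ)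
    (hA : ∀ i j, A i j = 0 ∨ A i j = 1) (q : ℝ) [Fact (1 < q)] :
    (Nonempty (TwoSidedShift A q) →
      IsExpansive (twoSidedShiftMap A q) ∧
      upperExpansiveDecay (twoSidedShiftMap A q) *
          (dimH (Set.univ : Set (TwoSidedShift A q)) : EReal) =
        Dynamics.coverEntropy (twoSidedShiftMap A q) Set.univ ∧
      lowerExpansiveDecay (twoSidedShiftMap A q) *
          (dimH (Set.univ : Set (TwoSidedShift A q)) : EReal) =
        Dynamics.coverEntropy (twoSidedShiftMap A q) Set.univ ∧
      (0 < Dynamics.coverEntropy (twoSidedShiftMap A q) Set.univ →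
        upperExpansiveDecay (twoSidedShiftMap A q) = ((Real.log q / 2 : ℝ) : EReal) ∧
        lowerExpansiveDecay (twoSidedShiftMap A q) = ((Real.log q / 2 : ℝ) : EReal)) ∧
      ∃ l : ℝ, Tendsto (fun k : ℕ => 1 / (k : ℝ) * Real.log ‖A ^ k‖) atTop (𝓝 l) ∧
        (dimH (Set.univ : Set (TwoSidedShift A q)) : EReal) =
          ((2 / Real.log q * l : ℝ) : EReal)) ∧
    (Nonempty (OneSidedShift A q) →
      IsExpansiveMap (oneSidedShiftMap A q) ∧
      upperExpansiveDecayMap (oneSidedShiftMap A q) *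
          (dimH (Set.univ : Set (OneSidedShift A q)) : EReal) =
        Dynamics.coverEntropy (oneSidedShiftMap A q) Set.univ ∧
      lowerExpansiveDecayMap (oneSidedShiftMap A q) *
          (dimH (Set.univ : Set (OneSidedShift A q)) : EReal) =
        Dynamics.coverEntropy (oneSidedShiftMap A q) Set.univ ∧
      (0 < Dynamics.coverEntropy (oneSidedShiftMap A q) Set.univ →
        upperExpansiveDecayMap (oneSidedShiftMap A q) = ((Real.log q : ℝ) : EReal) ∧
        lowerExpansiveDecayMap (oneSidedShiftMap A q) = ((Real.log q : ℝ) : EReal)) ∧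
      ∃ l : ℝ, Tendsto (fun k : ℕ => 1 / (k : ℝ) * Real.log ‖A ^ k‖) atTop (𝓝 l) ∧
        (dimH (Set.univ : Set (OneSidedShift A q)) : EReal) =
          ((1 / Real.log q * l : ℝ) : EReal)) := by

  have hlog := Real.log_pos (Fact.out : 1 < q)
  constructor
  · intro hne
    obtain ⟨l, hl0, hl, hexp⟩ := exists_growth_rate (TwoSidedShift.one_le_norm_pow (q := q) hA)
    have hnorm := TwoSidedShift.one_le_norm_pow (A := A) (q := q) hA
    have hent := TwoSidedShift.coverEntropy_eq (q := q) hA hnorm hl0 hl hexp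
    have hdim : (dimH (Set.univ : Set (TwoSidedShift A q)) : EReal) =
        ((2 / Real.log q * l : ℝ) : EReal) := by
      rw [TwoSidedShift.dimH_eq hA hnorm hl0 hl hexp, EReal.coe_ennreal_ofReal,
        max_eq_left (by positivity)]
    have hdecay : 0 < l →
        upperExpansiveDecay (twoSidedShiftMap A q) = ((Real.log q / 2 : ℝ) : EReal) ∧
          lowerExpansiveDecay (twoSidedShiftMap A q) = ((Real.log q / 2 : ℝ) : EReal) := fun hl1 => by
      obtain ⟨L, N, hL, hN, ⟨H⟩⟩ := exists_horseshoe hA (half_lt_self hl1) hexp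
      have hN1 : (1 : ℝ) < N := (Real.one_lt_exp_iff.2 (by positivity)).trans_le hN
      exact TwoSidedShift.expansiveDecay_eq (q := q) H hL (by exact_mod_cast hN1)
    have hdim' : (dimH (Set.univ : Set (TwoSidedShift A q)) : EReal) =
        ((1 / (Real.log q / 2) * l : ℝ) : EReal) := by
      rw [hdim, one_div_div]
    refine ⟨TwoSidedShift.isExpansive, ?_, ?_, fun hpos => ?_, l, hl, hdim⟩
    · rw [hent]
      exact decay_mul_dimH_eq (half_pos hlog) hl0 hdim' fun h => (hdecay h).1
    · rw [hent]
      exact decay_mul_dimH_eq (half_pos hlog) hl0 hdim' fun h => (hdecay h).2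
    · rw [hent] at hpos
      exact hdecay (by exact_mod_cast hpos)
  · intro hne
    obtain ⟨l, hl0, hl, hexp⟩ := exists_growth_rate (OneSidedShift.one_le_norm_pow (q := q) hA)
    have hnorm := OneSidedShift.one_le_norm_pow (A := A) (q := q) hA
    have hent := OneSidedShift.coverEntropy_eq (q := q) hA hnorm hl0 hl hexp
    have hdim : (dimH (Set.univ : Set (OneSidedShift A q)) : EReal) =
        ((1 / Real.log q * l : ℝ) : EReal) := by
      rw [OneSidedShift.dimH_eq hA hnorm hl0 hl hexp, EReal.coe_ennreal_ofReal,
        max_eq_left (by positivity)]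
    have hdecay : 0 < l →
        upperExpansiveDecayMap (oneSidedShiftMap A q) = ((Real.log q : ℝ) : EReal) ∧
          lowerExpansiveDecayMap (oneSidedShiftMap A q) = ((Real.log q : ℝ) : EReal) := fun hl1 => by
      obtain ⟨L, N, hL, hN, ⟨H⟩⟩ := exists_horseshoe hA (half_lt_self hl1) hexp
      have hN1 : (1 : ℝ) < N := (Real.one_lt_exp_iff.2 (by positivity)).trans_le hN
      exact OneSidedShift.expansiveDecayMap_eq (q := q) H hL (by exact_mod_cast hN1)
    refine ⟨OneSidedShift.isExpansiveMap, ?_, ?_, fun hpos => ?_, l, hl, hdim⟩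
    · rw [hent]
      exact decay_mul_dimH_eq hlog hl0 hdim fun h => (hdecay h).1
    · rw [hent]
      exact decay_mul_dimH_eq hlog hl0 hdim fun h => (hdecay h).2
    · rw [hent] at hpos
      exact hdecay (by exact_mod_cast hpos)
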